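/- Let $\Lambda$ be an artin algebra, i.e. a ring that is an algebra over a commutative artinian ring $R$ and finitely generated as an $R$-module. All modules are finitely generated left $\Lambda$-modules, $\mathrm{pd}$ is projective dimension (with $\mathrm{pd}\,0=0$), and $\Omega^n M$ is the $n$-th syzygy of $M$, formed with projective covers ($\Omega^0M=M$). Let $\mathcal S^{<\infty}$ and $\mathcal S^{\infty}$ be the sets of isomorphism classes of simple modules of finite, resp. infinite, projective dimension, let $\alpha=\sup\{\mathrm{pd}\,S: S\in\mathcal S^{<\infty}\}$ (which is $0$ if $\mathcal S^{<\infty}$ is empty), and let $\Sigma=\bigoplus_{S\in\mathcal S^\infty}S$. Let $\mathrm{fin.dim}\,\Lambda=\sup\{\mathrm{pd}\,M : \mathrm{pd}\,M<\infty\}$, and for a class $\mathscr D$ of modules let $\mathrm{fin.dim}\,\mathscr D=\sup\{\mathrm{pd}\,M: M\in\mathscr D,\ \mathrm{pd}\,M<\infty\}$ (with $\sup\emptyset=0$). As usual, $\mathrm{add}\,L$ is the class of direct summands of finite direct sums of copies of $L$. *Igusa–Todorov function.* Let $K$ be the abelian group generated by the symbols $[M]$ with relations $[C]=[A]+[B]$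 whenever $C\cong A\oplus B$ and $[P]=0$ for $P$ projective; $\Omega$ induces an endomorphism $\Omega[M]=[\Omega M]$ of $K$. Let $\langle M\rangle\subseteq K$ be the subgroup generated by the classes of the indecomposable direct summands of $M$, let $\Phi(M)$ be the smallest $n\ge 0$ such that $\Omega:\Omega^m\langle M\rangle\to\Omega^{m+1}\langle M\rangle$ is an isomorphism for all $m\ge n$, and put $\Psi(M)=\Phi(M)+\mathrm{fin.dim}\{X : X \text{ is a direct summand of } \Omega^{\Phi(M)}M\}$. *Infinite-layer length.* For a module $M$ let $S(M)\subseteq M$ be the smallest submodule such that $M/S(M)$ has a finite filtration with all factors simple of finite projective dimension. Put $F(M)=S(\mathrm{rad}\,M)$ and $\ell\ell^\infty(M)=\min\{i\ge 0 : F^i(S(M))=0\}$. *Two classes.* Let $\mathscr C(\Lambda)$ (resp. $\mathscr K(\Lambda)$) be the class of all indecomposable modules of infinite projective dimension that lie in $\mathrm{add}(M/\mathrm{soc}\,M)$ (resp. in $\mathrm{add}(\mathrm{rad}\,M)$) for some module $M$ with $\mathrm{pd}\,M<\infty$. **Theorem.** Let $s\in\mathbb N$ and let $L$ be a finitely generated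 $\Lambda$-module. (1) Suppose that $\Omega^s(X)\in\mathrm{add}\,L$ for all $X\in\mathscr C(\Lambda)$. Define $[\alpha]_L:\mathbb N\to\mathbb N$ by $[\alpha]_L(0)=\alpha$ and $$[\alpha]_L(i+1)=[\alpha]_L(i)+2+s+\Psi\big(\Omega^{1+s+[\alpha]_L(i)}(\Sigma)\oplus\Omega^{2+[\alpha]_L(i)}(L)\big)$$ (all these values are finite). Then $\mathrm{pd}\,M\le[\alpha]_L(\ell\ell^\infty(M))$ for every $M$ with $\mathrm{pd}\,M<\infty$, and $\mathrm{fin.dim}\,\Lambda\le[\alpha]_L(\ell\ell^\infty({}_\Lambda\Lambda))<\infty$. (2) Suppose that $\Omega^s(X)\in\mathrm{add}\,L$ for all $X\in\mathscr K(\Lambda)$. Define $\langle\alpha\rangle_L:\mathbb N\to\mathbb N$ by $\langle\alpha\rangle_L(0)=\alpha$ and $$\langle\alpha\rangle_L(i+1)=\langle\alpha\rangle_L(i)+2+s+\Psi\big(\Omega^{2+s+\langle\alpha\rangle_L(i)}(\Sigma)\oplus\Omega^{1+\langle\alpha\rangle_L(i)}(L)\big)$$ (all these values are finite). Then $\mathrm{pd}\,M\le\langle\alpha\rangle_L(\ell\ell^\infty(M))$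 for every $M$ with $\mathrm{pd}\,M<\infty$, and $\mathrm{fin.dim}\,\Lambda\le\langle\alpha\rangle_L(\ell\ell^\infty({}_\Lambda\Lambda))<\infty$. -/

import Mathlib

universe u v

namespace FinDim

open CategoryTheory

noncomputable section

variable {Λ : Type u} [Ring Λ]

/-! ### Projective dimension and finitistic dimension -/

/-- The projective dimension of a module, with the convention `pd 0 = 0`. -/
def pd (M : ModuleCat.{u} Λ) : ℕ∞ := (projectiveDimension M).unbotD 0

/-- The finitistic dimension of a class of modules: the supremum of the projective dimensions of
its members of finite projective dimension (zero if there is none). -/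
def finDimClass (𝒞 : ModuleCat.{u} Λ → Prop) : ℕ∞ :=
  ⨆ (M : ModuleCat.{u} Λ) (_ : 𝒞 M ∧ pd M < ⊤), pd M

variable (Λ) in
/-- The finitistic dimension of the ring. -/
def finDim : ℕ∞ := finDimClass fun M : ModuleCat.{u} Λ => Module.Finite Λ M

variable (Λ) in
/-- The supremum `α` of the projective dimensions of the simple modules of finite projective
dimension. -/
def alpha : ℕ∞ := finDimClass fun S : ModuleCat.{u} Λ => IsSimpleModule Λ S

/-! ### Direct summands and `add` -/

/-- `X` is (isomorphic to) a direct summand of `M`. -/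
def IsSummand (X M : ModuleCat.{u} Λ) : Prop :=
  ∃ Y : ModuleCat.{u} Λ, Nonempty (M ≃ₗ[Λ] X × Y)

/-- `X ∈ add L`: `X` is a direct summand of a finite direct sum of copies of `L`. -/
def InAdd (L X : ModuleCat.{u} Λ) : Prop :=
  ∃ n : ℕ, IsSummand X (ModuleCat.of Λ (Fin n → L))

/-- The direct sum of two modules. -/
def dsum (M N : ModuleCat.{u} Λ) : ModuleCat.{u} Λ := ModuleCat.of Λ (M × N)

/-! ### Projective covers and syzygies -/

/-- `f : P → M` is a projective cover of `M` (in the category of finitely generated modules):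
`P` is finitely generated projective, and `f` is surjective with superfluous kernel. -/
structure IsProjCover {P M : ModuleCat.{u} Λ} (f : P →ₗ[Λ] M) : Prop where
  finite : Module.Finite Λ P
  projective : Module.Projective Λ P
  surjective : Function.Surjective f
  superfluous : ∀ N : Submodule Λ P, N ⊔ LinearMap.ker f = ⊤ → N = ⊤

open Classical in
/-- The syzygy `Ω M`: the kernel of a projective cover of `M`. By `exists_isProjCover` a projective
cover exists if `M` is finitely generated over a left artinian ring; the value in all other cases
is irrelevant. -/
def syz (M : ModuleCat.{u} Λ) : ModuleCat.{u} Λ :=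
  if h : ∃ (P : ModuleCat.{u} Λ) (f : P →ₗ[Λ] M), IsProjCover f then
    ModuleCat.of Λ (LinearMap.ker h.choose_spec.choose)
  else M

/-- The iterated syzygy `Ω^n M`. -/
def syzPow (n : ℕ) (M : ModuleCat.{u} Λ) : ModuleCat.{u} Λ := syz^[n] M

theorem exists_isProjCover [IsArtinianRing Λ] (M : ModuleCat.{u} Λ) [Module.Finite Λ M] :
    ∃ (P : ModuleCat.{u} Λ) (f : P →ₗ[Λ] M), IsProjCover f := by
  let T := {P : ModuleCat.{u} Λ // Module.Finite Λ P ∧ Module.Projective Λ P ∧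
    ∃ f : P →ₗ[Λ] M, Function.Surjective f}
  obtain ⟨n, f₀, hf₀⟩ := Module.Finite.exists_fin' Λ M
  have : Nonempty T := ⟨⟨ModuleCat.of Λ (Fin n → Λ), inferInstanceAs (Module.Finite Λ (Fin n → Λ)),
    inferInstanceAs (Module.Projective Λ (Fin n → Λ)), f₀, hf₀⟩⟩
  let len : T → ℕ∞ := fun t => Module.length Λ t.1
  have hmin : ∀ t : T, len (Function.argmin len) ≤ len t := fun t => Function.argmin_le len t
  obtain ⟨⟨P, hP, hPp, f, hf⟩, hmin⟩ : ∃ t₀ : T, ∀ t, len t₀ ≤ len t := ⟨_, hmin⟩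
  refine ⟨P, f, hP, hPp, hf, fun N hN => ?_⟩
  have hfN : Function.Surjective (f.comp N.subtype) := by
    intro m
    obtain ⟨p, rfl⟩ := hf m
    obtain ⟨a, ha, k, hk, rfl⟩ := Submodule.mem_sup.1 (hN ▸ Submodule.mem_top : p ∈ N ⊔ _)
    exact ⟨⟨a, ha⟩, by simp [LinearMap.mem_ker.1 hk]⟩
  obtain ⟨g, hg⟩ := Module.projective_lifting_property _ f hfN
  let e : Module.End Λ P := N.subtype.comp g
  have he : ∀ p, f (e p) = f p := fun p => LinearMap.congr_fun hg p
  have hen : ∀ k p, f ((e ^ k) p) = f p := by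
    intro k
    induction k with
    | zero => intro p; simp
    | succ k ih => intro p; rw [pow_succ, Module.End.mul_apply, ih, he]
  obtain ⟨k, hk, hk1⟩ := (e.eventually_isCompl_ker_pow_range_pow.and
    (Filter.eventually_ge_atTop 1)).exists
  let W : Submodule Λ P := LinearMap.range (e ^ k)
  have hWp : Module.Projective Λ W :=
    Module.Projective.of_split W.subtype (W.projectionOnto _ hk.symm)
      (by ext x; simp)
  have hW : W = ⊤ := by
    by_contra hne
    have h1 := hmin ⟨ModuleCat.of Λ W, inferInstanceAs (Module.Finite Λ W), hWp,
      f.comp W.subtype, fun m => by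
        obtain ⟨p, rfl⟩ := hf m
        exact ⟨⟨(e ^ k) p, p, rfl⟩, hen k p⟩⟩
    exact absurd h1 (not_le.2 (Submodule.length_lt hne))
  rw [eq_top_iff, ← hW]
  rintro _ ⟨p, rfl⟩
  obtain ⟨j, rfl⟩ : ∃ j, k = j + 1 := ⟨k - 1, by omega⟩
  rw [pow_succ', Module.End.mul_apply]
  exact (g _).2

/-- Projective covers are unique: isomorphic modules have isomorphic kernels of projective
covers. -/
theorem IsProjCover.ker_equiv {P M P' M' : ModuleCat.{u} Λ} {f : P →ₗ[Λ] M} {f' : P' →ₗ[Λ] M'}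
    (hf : IsProjCover f) (hf' : IsProjCover f') (e : M ≃ₗ[Λ] M') :
    Nonempty (LinearMap.ker f ≃ₗ[Λ] LinearMap.ker f') := by
  have := hf.projective
  have := hf'.projective
  obtain ⟨g, hg⟩ := Module.projective_lifting_property f' (e.toLinearMap.comp f) hf'.surjective
  have hg' : ∀ p, f' (g p) = e (f p) := fun p => LinearMap.congr_fun hg p
  have hgs : Function.Surjective g := by
    rw [← LinearMap.range_eq_top]
    refine hf'.superfluous _ (eq_top_iff.2 fun q _ => ?_)
    obtain ⟨p, hp⟩ := hf.surjective (e.symm (f' q))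
    refine Submodule.mem_sup.2 ⟨g p, ⟨p, rfl⟩, q - g p, ?_, by abel⟩
    simp [hg', hp]
  obtain ⟨h, hh⟩ := Module.projective_lifting_property g LinearMap.id hgs
  have hh' : ∀ q, g (h q) = q := fun q => LinearMap.congr_fun hh q
  have hhs : LinearMap.range h = ⊤ := by
    refine hf.superfluous _ (eq_top_iff.2 fun p _ => ?_)
    refine Submodule.mem_sup.2 ⟨h (g p), ⟨_, rfl⟩, p - h (g p), ?_, by abel⟩
    rw [LinearMap.mem_ker, map_sub, sub_eq_zero]
    apply e.injective
    rw [← hg', ← hg', hh']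
  have hgi : Function.Injective g := by
    intro a b hab
    obtain ⟨a, rfl⟩ := LinearMap.range_eq_top.1 hhs a
    obtain ⟨b, rfl⟩ := LinearMap.range_eq_top.1 hhs b
    rw [hh', hh'] at hab
    rw [hab]
  let G : P ≃ₗ[Λ] P' := LinearEquiv.ofBijective g ⟨hgi, hgs⟩
  refine ⟨G.ofSubmodules _ _ ?_⟩
  ext q
  rw [Submodule.mem_map_equiv, LinearMap.mem_ker, LinearMap.mem_ker]
  have h2 := hg' (G.symm q)
  rw [show g (G.symm q) = q from G.apply_symm_apply q] at h2
  rw [h2, e.map_eq_zero_iff]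

theorem IsProjCover.prodMap {P M P' M' : ModuleCat.{u} Λ} {f : P →ₗ[Λ] M} {f' : P' →ₗ[Λ] M'}
    (hf : IsProjCover f) (hf' : IsProjCover f') :
    IsProjCover (P := dsum P P') (M := dsum M M') (f.prodMap f') := by
  have := hf.projective
  have := hf'.projective
  have := hf.finite
  have := hf'.finite
  refine ⟨inferInstanceAs (Module.Finite Λ (P × P')), inferInstanceAs (Module.Projective Λ (P × P')),
    Function.Surjective.prodMap hf.surjective hf'.surjective, fun (N : Submodule Λ (P × P')) hN => ?_⟩
  replace hN : ∀ p p', (p, p') ∈ N ⊔ LinearMap.ker (f.prodMap f') := fun p p' => by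
    rw [show N ⊔ LinearMap.ker (f.prodMap f') = ⊤ from hN]; trivial
  have hfst : ∀ p, ∃ k, f k = 0 ∧ ∃ k', f' k' = 0 ∧ (p - k, - k') ∈ N := by
    intro p
    obtain ⟨⟨a, b⟩, hab, ⟨k, k'⟩, hk, h⟩ := Submodule.mem_sup.1 (hN p 0)
    simp only [LinearMap.mem_ker, LinearMap.prodMap_apply, Prod.mk_eq_zero] at hk
    simp only [Prod.mk_add_mk, Prod.mk.injEq] at h
    refine ⟨k, hk.1, k', hk.2, ?_⟩
    rwa [← h.1, add_sub_cancel_right, ← eq_neg_of_add_eq_zero_left h.2]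
  have hsnd : ∀ p', ∃ k, f k = 0 ∧ ∃ k', f' k' = 0 ∧ (- k, p' - k') ∈ N := by
    intro p
    obtain ⟨⟨a, b⟩, hab, ⟨k, k'⟩, hk, h⟩ := Submodule.mem_sup.1 (hN 0 p)
    simp only [LinearMap.mem_ker, LinearMap.prodMap_apply, Prod.mk_eq_zero] at hk
    simp only [Prod.mk_add_mk, Prod.mk.injEq] at h
    refine ⟨k, hk.1, k', hk.2, ?_⟩
    rwa [← h.2, add_sub_cancel_right, ← eq_neg_of_add_eq_zero_left h.1]
  -- first projection of `N ⊓ (P × ker f')` is everything, so `N` maps onto `P'` within `0 × P'`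
  have h1 : ∀ p, ∃ k', f' k' = 0 ∧ (p, k') ∈ N := by
    let A : Submodule Λ P := (N ⊓ (LinearMap.ker f').comap (LinearMap.snd Λ P P')).map
      (LinearMap.fst Λ P P')
    have hA : A = ⊤ := by
      refine hf.superfluous A (eq_top_iff.2 fun p _ => ?_)
      obtain ⟨k, hk, k', hk', h⟩ := hfst p
      refine Submodule.mem_sup.2 ⟨p - k, ⟨(p - k, -k'), ⟨h, ?_⟩, rfl⟩, k, hk, by abel⟩
      simp [hk']
    intro p
    obtain ⟨⟨q, k'⟩, ⟨h, hk'⟩, rfl⟩ : p ∈ A := hA ▸ Submodule.mem_top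
    exact ⟨k', hk', h⟩
  have h2 : ∀ p', ((0 : P), p') ∈ N := by
    let B : Submodule Λ P' := N.comap (LinearMap.inr Λ P P')
    have hB : B = ⊤ := by
      refine hf'.superfluous B (eq_top_iff.2 fun p' _ => ?_)
      obtain ⟨k, hk, k', hk', h⟩ := hsnd p'
      obtain ⟨l, hl, hl'⟩ := h1 k
      refine Submodule.mem_sup.2 ⟨p' - k' + l, ?_, k' - l, ?_, by abel⟩
      · have := N.add_mem h hl'
        simpa [B] using this
      · simp [hk', hl]
    intro p'
    exact (hB ▸ Submodule.mem_top : p' ∈ B)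
  refine eq_top_iff.2 fun ⟨p, p'⟩ _ => ?_
  obtain ⟨k', -, hk⟩ := h1 p
  have h3 : (p, k') + ((0 : P), p' - k') ∈ N := N.add_mem hk (h2 (p' - k'))
  rw [Prod.mk_add_mk, add_zero, add_sub_cancel] at h3
  exact h3

theorem syz_equiv_ker {P M : ModuleCat.{u} Λ} {f : P →ₗ[Λ] M} (hf : IsProjCover f) :
    Nonempty (syz M ≃ₗ[Λ] LinearMap.ker f) := by
  have h : ∃ (P : ModuleCat.{u} Λ) (f : P →ₗ[Λ] M), IsProjCover f := ⟨P, f, hf⟩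
  rw [syz, dif_pos h]
  exact h.choose_spec.choose_spec.ker_equiv hf (LinearEquiv.refl Λ M)

theorem finite_syz [IsArtinianRing Λ] (M : ModuleCat.{u} Λ) [Module.Finite Λ M] :
    Module.Finite Λ (syz M) := by
  obtain ⟨P, f, hf⟩ := exists_isProjCover M
  obtain ⟨e⟩ := syz_equiv_ker hf
  have := hf.finite
  exact Module.Finite.equiv e.symm

theorem syz_equiv_prod [IsArtinianRing Λ] {C A B : ModuleCat.{u} Λ} [Module.Finite Λ A]
    [Module.Finite Λ B] (e : C ≃ₗ[Λ] A × B) : Nonempty (syz C ≃ₗ[Λ] syz A × syz B) := by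
  obtain ⟨P, f, hf⟩ := exists_isProjCover A
  obtain ⟨P', f', hf'⟩ := exists_isProjCover B
  have : Module.Finite Λ C := Module.Finite.equiv e.symm
  obtain ⟨P'', f'', hf''⟩ := exists_isProjCover C
  obtain ⟨i⟩ := syz_equiv_ker hf
  obtain ⟨i'⟩ := syz_equiv_ker hf'
  obtain ⟨i''⟩ := syz_equiv_ker hf''
  obtain ⟨j⟩ := hf''.ker_equiv (hf.prodMap hf') e
  let k : LinearMap.ker (f.prodMap f') ≃ₗ[Λ] LinearMap.ker f × LinearMap.ker f' :=
    { toFun := fun x => (⟨x.1.1, congrArg Prod.fst x.2⟩, ⟨x.1.2, congrArg Prod.snd x.2⟩)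
      invFun := fun y => ⟨(y.1.1, y.2.1), Prod.ext y.1.2 y.2.2⟩
      map_add' := fun _ _ => rfl
      map_smul' := fun _ _ => rfl
      left_inv := fun _ => rfl
      right_inv := fun _ => rfl }
  exact ⟨i'' ≪≫ₗ j ≪≫ₗ k ≪≫ₗ (i.prodCongr i').symm⟩

theorem subsingleton_syz_of_projective {P : ModuleCat.{u} Λ} [Module.Finite Λ P]
    [Module.Projective Λ P] : Subsingleton (syz P) := by
  have h : IsProjCover (LinearMap.id : P →ₗ[Λ] P) :=
    ⟨inferInstance, inferInstance, Function.surjective_id, fun N hN => by simpa using hN⟩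
  obtain ⟨e⟩ := syz_equiv_ker h
  have : Subsingleton (LinearMap.ker (LinearMap.id : P →ₗ[Λ] P)) := by
    rw [LinearMap.ker_id]; infer_instance
  exact e.toEquiv.subsingleton

/-! ### The Igusa–Todorov function -/

variable (Λ) in
/-- Finitely generated modules. -/
abbrev FMod := {M : ModuleCat.{u} Λ // Module.Finite Λ M}

variable (Λ) in
/-- The relations `[C] - [A] - [B]` for `C ≅ A ⊕ B`, and `[P]` for `P` projective, in the free
abelian group on the symbols `[M]`. -/
def relK : Submodule ℤ (FMod Λ →₀ ℤ) :=
  Submodule.span ℤ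
    ({x | ∃ A B C : FMod Λ, Nonempty (C.1 ≃ₗ[Λ] A.1 × B.1) ∧
        x = Finsupp.single C 1 - Finsupp.single A 1 - Finsupp.single B 1} ∪
      {x | ∃ P : FMod Λ, Module.Projective Λ P.1 ∧ x = Finsupp.single P 1})

variable (Λ) in
/-- The group `K`: the split Grothendieck group of finitely generated modules modulo the classes
of the projective modules. -/
abbrev GrK := (FMod Λ →₀ ℤ) ⧸ relK Λ

/-- The class `[M]` in `K`. -/
def cls (M : FMod Λ) : GrK Λ := (relK Λ).mkQ (Finsupp.single M 1)

/-- The syzygy as an operation on finitely generated modules. -/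
def syzF [IsArtinianRing Λ] (M : FMod Λ) : FMod Λ :=
  ⟨syz M.1, haveI := M.2; finite_syz M.1⟩

variable (Λ) in
theorem relK_le_comap [IsArtinianRing Λ] :
    relK Λ ≤ (relK Λ).comap (Finsupp.lmapDomain ℤ ℤ (syzF (Λ := Λ))) := by
  rw [relK, Submodule.span_le]
  rintro _ (⟨A, B, C, ⟨e⟩, rfl⟩ | ⟨P, hP, rfl⟩)
  · have := A.2
    have := B.2
    refine Submodule.subset_span (Or.inl ⟨syzF A, syzF B, syzF C, syz_equiv_prod e, ?_⟩)
    rw [map_sub, map_sub]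
    simp only [Finsupp.lmapDomain_apply, Finsupp.mapDomain_single]
  · have := P.2
    have : Subsingleton (syz P.1) := subsingleton_syz_of_projective
    have hz : Module.Projective Λ (syz P.1) :=
      Module.Projective.of_basis (Module.Basis.empty (ι := PEmpty.{u + 1}) (syz P.1))
    refine Submodule.subset_span (Or.inr ⟨syzF P, ?_, ?_⟩)
    · exact hz
    · simp [Finsupp.mapDomain_single]

variable (Λ) in
/-- The endomorphism `Ω` of `K` with `Ω [M] = [Ω M]`. -/
def omegaK [IsArtinianRing Λ] : Module.End ℤ (GrK Λ) :=
  Submodule.mapQ (relK Λ) (relK Λ) (Finsupp.lmapDomain ℤ ℤ (syzF (Λ := Λ))) (relK_le_comap Λ)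

theorem omegaK_cls [IsArtinianRing Λ] (M : FMod Λ) : omegaK Λ (cls M) = cls (syzF M) := by
  simp [omegaK, cls, Finsupp.mapDomain_single]

/-- The subgroup `⟨M⟩` of `K` generated by the classes of the indecomposable direct summands of
`M`. -/
def genK (M : ModuleCat.{u} Λ) : Submodule ℤ (GrK Λ) :=
  Submodule.span ℤ {x | ∃ X : FMod Λ, Indecomposable X.1 ∧ IsSummand X.1 M ∧ x = cls X}

/-- `Φ(M)`: the smallest `n` such that `Ω : Ω^m ⟨M⟩ → Ω^(m+1) ⟨M⟩` is an isomorphism for all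
`m ≥ n` (it would be `⊤` if there were no such `n`). -/
def igusaPhi [IsArtinianRing Λ] (M : ModuleCat.{u} Λ) : ℕ∞ :=
  ⨅ (n : ℕ) (_ : ∀ m ≥ n, Set.BijOn (omegaK Λ) ((genK M).map (omegaK Λ ^ m))
    ((genK M).map (omegaK Λ ^ (m + 1)))), (n : ℕ∞)

/-- `Ψ(M) = Φ(M) + fin.dim 𝒞_M`, where `𝒞_M` is the class of the direct summands of
`Ω^(Φ(M)) M`. -/
def igusaPsi [IsArtinianRing Λ] (M : ModuleCat.{u} Λ) : ℕ∞ :=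
  igusaPhi M + finDimClass fun X => IsSummand X (syzPow (igusaPhi M).toNat M)

/-! ### The functor `S` and the infinite-layer length -/

/-- `M` is filtered by the simple modules of finite projective dimension: there is a chain
`0 = M₀ ⊆ M₁ ⊆ ⋯ ⊆ Mₘ = M` with every `Mᵢ₊₁ / Mᵢ` simple of finite projective dimension. -/
def FiltFin (M : ModuleCat.{u} Λ) : Prop :=
  ∃ (m : ℕ) (c : ℕ → Submodule Λ M), c 0 = ⊥ ∧ c m = ⊤ ∧ ∀ i < m, c i ≤ c (i + 1) ∧
    IsSimpleModule Λ (c (i + 1) ⧸ (c i).submoduleOf (c (i + 1))) ∧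
    pd (ModuleCat.of Λ (c (i + 1) ⧸ (c i).submoduleOf (c (i + 1)))) < ⊤

/-- The functor `S` on objects: `S(M)` is the kernel of the largest quotient of `M` filtered by
the simple modules of finite projective dimension, that is, the smallest submodule `N` for which
`M / N` is so filtered. -/
def funS (M : ModuleCat.{u} Λ) : ModuleCat.{u} Λ :=
  ModuleCat.of Λ (sInf {N : Submodule Λ M | FiltFin (ModuleCat.of Λ (M ⧸ N))} : Submodule Λ M)

/-- The radical of a module: the intersection of its maximal submodules. -/
def radM (M : ModuleCat.{u} Λ) : ModuleCat.{u} Λ := ModuleCat.of Λ (Module.jacobson Λ M)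

/-- The infinite-layer length: the least `i` with `F^i (S(M)) = 0`, where `F = S ∘ rad`. -/
def infLayerLength (M : ModuleCat.{u} Λ) : ℕ :=
  sInf {i : ℕ | Subsingleton ((fun X => funS (radM X))^[i] (funS M))}

/-- For finitely generated `M` the set whose minimum defines the infinite-layer length is not
empty. -/
theorem exists_infLayerLength [IsArtinianRing Λ] (M : ModuleCat.{u} Λ) [Module.Finite Λ M] :
    ∃ i : ℕ, Subsingleton ((fun X => funS (radM X))^[i] (funS M)) := by
  have key : ∀ (n : ℕ) (X : ModuleCat.{u} Λ), Module.Finite Λ X → Module.length Λ X ≤ n →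
      Subsingleton ((fun X => funS (radM X))^[n] X) := by
    intro n
    induction n with
    | zero =>
      intro X _ h
      rw [Function.iterate_zero_apply]
      exact Module.length_eq_zero_iff.1 (le_antisymm h bot_le)
    | succ n ih =>
      intro X hX h
      rw [Function.iterate_succ_apply]
      have hr : Module.Finite Λ (radM X) := inferInstanceAs (Module.Finite Λ (Module.jacobson Λ X))
      refine ih _ (inferInstanceAs (Module.Finite Λ (_ : Submodule Λ (radM X)))) ?_
      rcases subsingleton_or_nontrivial X with hs | hn
      · have : Subsingleton (funS (radM X)) :=
          inferInstanceAs (Subsingleton (_ : Submodule Λ (Module.jacobson Λ X)))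
        rw [Module.length_eq_zero_iff.2 this]
        exact bot_le
      · have h1 : Module.length Λ (funS (radM X)) ≤ Module.length Λ (Module.jacobson Λ X) :=
          Module.length_le_of_injective (Submodule.subtype _) (Submodule.injective_subtype _)
        have h2 : Module.length Λ (Module.jacobson Λ X) < Module.length Λ X :=
          Submodule.length_lt (Module.jacobson_lt_top Λ X).ne
        have h3 : Module.length Λ (funS (radM X)) < (n : ℕ∞) + 1 := (h1.trans_lt h2).trans_le h
        exact (ENat.lt_add_one_iff (ENat.natCast_ne_top n)).1 h3
  have hf : Module.Finite Λ (funS M) := inferInstanceAs (Module.Finite Λ (_ : Submodule Λ M))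
  have hl : Module.length Λ (funS M) ≠ ⊤ := Module.length_ne_top
  exact ⟨_, key _ (funS M) hf (ENat.natCast_toNat hl).ge⟩

/-! ### The classes `𝒞(Λ)` and `𝒦(Λ)`, and the module `Σ` -/

/-- The quotient of a module by its socle (the sum of its simple submodules). -/
def modSoc (M : ModuleCat.{u} Λ) : ModuleCat.{u} Λ :=
  ModuleCat.of Λ (M ⧸ sSup {N : Submodule Λ M | IsSimpleModule Λ N})

/-- `𝒞(Λ)`: the indecomposable modules of infinite projective dimension in `add (M / soc M)` for
some finitely generated module `M` of finite projective dimension. -/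
def classC (X : ModuleCat.{u} Λ) : Prop :=
  Indecomposable X ∧ pd X = ⊤ ∧
    ∃ M : ModuleCat.{u} Λ, Module.Finite Λ M ∧ pd M < ⊤ ∧ InAdd (modSoc M) X

/-- `𝒦(Λ)`: the indecomposable modules of infinite projective dimension in `add (rad M)` for
some finitely generated module `M` of finite projective dimension. -/
def classK (X : ModuleCat.{u} Λ) : Prop :=
  Indecomposable X ∧ pd X = ⊤ ∧
    ∃ M : ModuleCat.{u} Λ, Module.Finite Λ M ∧ pd M < ⊤ ∧ InAdd (radM M) X

variable (Λ) in
/-- Maximal left ideals `I` and `J` are equivalent if `Λ / I ≅ Λ / J`. The equivalence classes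
correspond to the isomorphism classes of simple modules. -/
def simpleSetoid : Setoid {I : Submodule Λ Λ // IsCoatom I} where
  r I J := Nonempty ((Λ ⧸ I.1) ≃ₗ[Λ] (Λ ⧸ J.1))
  iseqv := ⟨fun _ => ⟨LinearEquiv.refl _ _⟩, fun ⟨e⟩ => ⟨e.symm⟩, fun ⟨e⟩ ⟨f⟩ => ⟨e ≪≫ₗ f⟩⟩

/-- A simple module in the given isomorphism class. -/
def simpleRep (c : Quotient (simpleSetoid Λ)) : ModuleCat.{u} Λ := ModuleCat.of Λ (Λ ⧸ c.out.1)

variable (Λ) in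
/-- The module `Σ`: the direct sum of the simple modules of infinite projective dimension, one from
each isomorphism class. -/
def sigmaInf : ModuleCat.{u} Λ :=
  ModuleCat.of Λ
    (DirectSum {c : Quotient (simpleSetoid Λ) // pd (simpleRep c) = ⊤} fun c => simpleRep c.1)

/-! ### The bounding functions -/

/-- The function `[t]_L`:
`[t]_L(0) = t` and
`[t]_L(i+1) = [t]_L(i) + 2 + s + Ψ(Ω^(1+s+[t]_L(i)) Σ ⊕ Ω^(2+[t]_L(i)) L)`. -/
def boundC [IsArtinianRing Λ] (s : ℕ) (L : ModuleCat.{u} Λ) (t : ℕ∞) : ℕ → ℕ∞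
  | 0 => t
  | i + 1 => boundC s L t i + 2 + s +
      igusaPsi (dsum (syzPow (1 + s + (boundC s L t i).toNat) (sigmaInf Λ))
        (syzPow (2 + (boundC s L t i).toNat) L))

/-- The function `⟨t⟩_L`:
`⟨t⟩_L(0) = t` and
`⟨t⟩_L(i+1) = ⟨t⟩_L(i) + 2 + s + Ψ(Ω^(2+s+⟨t⟩_L(i)) Σ ⊕ Ω^(1+⟨t⟩_L(i)) L)`. -/
def boundK [IsArtinianRing Λ] (s : ℕ) (L : ModuleCat.{u} Λ) (t : ℕ∞) : ℕ → ℕ∞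
  | 0 => t
  | i + 1 => boundK s L t i + 2 + s +
      igusaPsi (dsum (syzPow (2 + s + (boundK s L t i).toNat) (sigmaInf Λ))
        (syzPow (1 + (boundK s L t i).toNat) L))

end

end FinDim

open FinDim

namespace FinDim

open CategoryTheory Abelian

variable {Λ : Type u} [Ring Λ]

/-! ### Projective dimension -/

/-! The homological engine is the Igusa–Todorov inequality `SES.pd_le_igusaPsi`: for `0 → A → B → C
→ 0` exact with `pd C < ∞`, one has `pd C ≤ Ψ(A ⊕ B) + 1`. A high syzygy of `C` is projective, so
`[A]` and `[B]` agree in `K` after a high power of `Ω`, hence, by the definition of `Φ`, already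
after `φ = Φ(A ⊕ B)` steps. Finitely generated modules can be cancelled, so equality in `K` is
stable isomorphism, and up to projective summands the `φ`-th syzygy of the sequence reads `0 → X → X
⊕ P → C' → 0`. Fitting's lemma splits off the part of `X` on which the component `X → X` is
bijective. On the remaining summand `Z` this component is nilpotent, and the long exact Ext sequence
forces `pd Z < ∞`. So `pd C' ≤ pd Z + 1`, and `pd Z` is bounded by the second term of `Ψ`.

The structural input is that a module of infinite-layer length `i` has `i` semisimple layers
separated by layers whose simple factors all have finite projective dimension. Bracketed from the
bottom this is `Lay i`, from the top `Up i`.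

The bounds follow by induction on `i`, with `t` the bound for `i` layers. For (2), shrink `M` with
`i + 1` layers to `N ⊆ M` such that `M / N` has only simple factors of finite projective dimension,
`top N` lies in `add Σ` and `rad N` has `i` layers. Then `pd M ≤ max (pd N) α`. An indecomposable
summand of `rad N` either has finite projective dimension, hence at most `t` by induction, or lies
in `𝒦(Λ)`, so that its `s`-th syzygy is in `add L`. Rotating `0 → rad N → N → top N → 0` makes `N`
the right-hand term; after `m = s + t + 1` syzygies the other two terms are, up to projectives, in
`add (Ω^(2+s+t) Σ ⊕ Ω^(1+t) L)`, and the inequality applies. Part (1) is dual: pass to a quotient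
`N` of `M` and use `0 → soc N → N → N / soc N → 0`.

All comparisons of the form "in `add W` up to projectives" go through the relation `Dom`, under
which `Φ` and `Ψ` are monotone. -/

theorem pd_le_iff (M : ModuleCat.{u} Λ) (n : ℕ) :
    pd M ≤ n ↔ HasProjectiveDimensionLT M (n + 1) := by
  rw [← projectiveDimension_lt_iff, pd]
  generalize projectiveDimension M = d
  induction d with
  | bot => simp
  | coe d =>
    rw [WithBot.unbotD_coe, ← ENat.lt_add_one_iff (ENat.natCast_ne_top n)]
    exact (WithBot.coe_lt_coe (a := d) (b := (n : ℕ∞) + 1)).symm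

theorem pd_lt_top_iff (M : ModuleCat.{u} Λ) : pd M < ⊤ ↔ ∃ n : ℕ, pd M ≤ n := by
  constructor
  · intro h
    exact ⟨(pd M).toNat, (ENat.natCast_toNat h.ne).ge⟩
  · rintro ⟨n, h⟩
    exact h.trans_lt (ENat.natCast_lt_top n)

theorem pd_congr {M N : ModuleCat.{u} Λ} (e : M ≃ₗ[Λ] N) : pd M = pd N := by
  rw [pd, pd, projectiveDimension_eq_of_iso e.toModuleIso]

theorem pd_le_zero_iff (M : ModuleCat.{u} Λ) : pd M ≤ 0 ↔ Module.Projective Λ M := by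
  rw [← Nat.cast_zero, pd_le_iff, zero_add, ← projective_iff_hasProjectiveDimensionLT_one]
  exact (IsProjective.iff_projective M).symm

theorem pd_eq_zero (M : ModuleCat.{u} Λ) [h : Module.Projective Λ M] : pd M = 0 :=
  le_antisymm ((pd_le_zero_iff M).2 h) bot_le

theorem pd_le_of_summand {X M : ModuleCat.{u} Λ} (h : IsSummand X M) : pd X ≤ pd M := by
  obtain ⟨Y, ⟨e⟩⟩ := h
  let r : Retract X M :=
    ⟨ModuleCat.ofHom (e.symm.toLinearMap ∘ₗ LinearMap.inl Λ X Y),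
      ModuleCat.ofHom (LinearMap.fst Λ X Y ∘ₗ e.toLinearMap), by ext x; simp⟩
  rw [pd, pd]
  have := r.projectiveDimension_le
  revert this
  generalize projectiveDimension X = a
  generalize projectiveDimension M = b
  induction a with
  | bot => simp
  | coe a =>
    induction b with
    | bot => simp
    | coe b => exact WithBot.coe_le_coe.1

/-! ### Short exact sequences -/

/-- There is a short exact sequence `0 → A → B → C → 0`. -/
def SES (A B C : ModuleCat.{u} Λ) : Prop :=
  ∃ (f : A →ₗ[Λ] B) (g : B →ₗ[Λ] C),
    Function.Injective f ∧ Function.Exact f g ∧ Function.Surjective g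

theorem SES.exists_shortExact {A B C : ModuleCat.{u} Λ} (h : SES A B C) :
    ∃ (f : A ⟶ B) (g : B ⟶ C) (w : f ≫ g = 0), (ShortComplex.mk f g w).ShortExact := by
  obtain ⟨f, g, hf, hfg, hg⟩ := h
  refine ⟨ModuleCat.ofHom f, ModuleCat.ofHom g, ?_, ?_⟩
  · ext x
    exact hfg.apply_apply_eq_zero x
  · exact ModuleCat.shortComplex_shortExact _ hfg hf hg

theorem SES.pd_mid {A B C : ModuleCat.{u} Λ} (h : SES A B C) {n : ℕ} (hA : pd A ≤ n)
    (hC : pd C ≤ n) : pd B ≤ n := by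
  obtain ⟨f, g, w, hS⟩ := h.exists_shortExact
  rw [pd_le_iff] at *
  exact hS.hasProjectiveDimensionLT_X₂ _ hA hC

theorem SES.pd_right {A B C : ModuleCat.{u} Λ} (h : SES A B C) {n : ℕ} (hA : pd A ≤ n)
    (hB : pd B ≤ (n + 1 : ℕ)) : pd C ≤ (n + 1 : ℕ) := by
  obtain ⟨f, g, w, hS⟩ := h.exists_shortExact
  rw [pd_le_iff] at *
  exact hS.hasProjectiveDimensionLT_X₃ _ hA hB

theorem SES.pd_left {A B C : ModuleCat.{u} Λ} (h : SES A B C) {n : ℕ} (hB : pd B ≤ n)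
    (hC : pd C ≤ (n + 1 : ℕ)) : pd A ≤ n := by
  obtain ⟨f, g, w, hS⟩ := h.exists_shortExact
  rw [pd_le_iff] at *
  exact hS.hasProjectiveDimensionLT_X₁ _ hB hC

theorem SES.pd_left_lt_top {A B C : ModuleCat.{u} Λ} (h : SES A B C) (hB : pd B < ⊤)
    (hC : pd C < ⊤) : pd A < ⊤ := by
  rw [pd_lt_top_iff] at *
  obtain ⟨m, hm⟩ := hB
  obtain ⟨n, hn⟩ := hC
  refine ⟨max m n, h.pd_left (hm.trans ?_) (hn.trans ?_)⟩ <;> norm_cast <;> omega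

theorem SES.pd_right_lt_top {A B C : ModuleCat.{u} Λ} (h : SES A B C) (hA : pd A < ⊤)
    (hB : pd B < ⊤) : pd C < ⊤ := by
  rw [pd_lt_top_iff] at *
  obtain ⟨m, hm⟩ := hA
  obtain ⟨n, hn⟩ := hB
  refine ⟨max m n + 1, h.pd_right (hm.trans ?_) (hn.trans ?_)⟩ <;> norm_cast <;> omega

theorem SES.congr {A B C A' B' C' : ModuleCat.{u} Λ} (h : SES A B C) (a : A ≃ₗ[Λ] A')
    (b : B ≃ₗ[Λ] B') (c : C ≃ₗ[Λ] C') : SES A' B' C' := by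
  obtain ⟨f, g, hf, hfg, hg⟩ := h
  refine ⟨b.toLinearMap ∘ₗ f ∘ₗ a.symm.toLinearMap, c.toLinearMap ∘ₗ g ∘ₗ b.symm.toLinearMap,
    ?_, ?_, ?_⟩
  · exact b.injective.comp (hf.comp a.symm.injective)
  · intro x
    have h1 := hfg (b.symm x)
    simp only [LinearMap.comp_apply, LinearEquiv.coe_coe, LinearEquiv.map_eq_zero_iff, h1,
      Set.mem_range]
    constructor
    · rintro ⟨y, hy⟩
      exact ⟨a y, by simp [hy]⟩
    · rintro ⟨y, rfl⟩
      exact ⟨a.symm y, by simp⟩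
  · exact c.surjective.comp (hg.comp b.symm.surjective)

theorem SES.of_submodule {M : ModuleCat.{u} Λ} (N : Submodule Λ M) :
    SES (ModuleCat.of Λ N) M (ModuleCat.of Λ (M ⧸ N)) :=
  ⟨N.subtype, N.mkQ, N.injective_subtype, LinearMap.exact_subtype_mkQ N, N.mkQ_surjective⟩

theorem SES.prod_left {A B C : ModuleCat.{u} Λ} (h : SES A B C) (D : ModuleCat.{u} Λ) :
    SES (dsum A D) (dsum B D) C := by
  obtain ⟨f, g, hf, hfg, hg⟩ := h
  refine ⟨(f.prodMap LinearMap.id : A × D →ₗ[Λ] B × D), (g ∘ₗ LinearMap.fst Λ B D : B × D →ₗ[Λ] C),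
    Function.Injective.prodMap hf Function.injective_id, ?_, ?_⟩
  · rintro ⟨b, d⟩
    have h1 := hfg b
    constructor
    · intro h
      obtain ⟨a, rfl⟩ := h1.1 h
      exact ⟨(a, d), rfl⟩
    · rintro ⟨⟨a, d'⟩, h⟩
      exact h1.2 ⟨a, congrArg Prod.fst h⟩
  · exact hg.comp Prod.fst_surjective

theorem SES.prod_right {A B C : ModuleCat.{u} Λ} (h : SES A B C) (D : ModuleCat.{u} Λ) :
    SES A (dsum B D) (dsum C D) := by
  obtain ⟨f, g, hf, hfg, hg⟩ := h
  refine ⟨(LinearMap.inl Λ B D ∘ₗ f : A →ₗ[Λ] B × D), (g.prodMap LinearMap.id : B × D →ₗ[Λ] C × D),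
    (LinearMap.inl_injective).comp hf, ?_, Function.Surjective.prodMap hg Function.surjective_id⟩
  rintro ⟨b, d⟩
  have h1 := hfg b
  constructor
  · intro h
    obtain ⟨a, rfl⟩ := h1.1 (congrArg Prod.fst h)
    refine ⟨a, Prod.ext rfl (congrArg Prod.snd h).symm⟩
  · rintro ⟨a, h⟩
    obtain rfl : f a = b := congrArg Prod.fst h
    obtain rfl : 0 = d := congrArg Prod.snd h
    exact Prod.ext (hfg.apply_apply_eq_zero a) rfl

theorem SES.dsum (A B : ModuleCat.{u} Λ) : SES A (dsum A B) B :=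
  ⟨LinearMap.inl Λ A B, LinearMap.snd Λ A B, LinearMap.inl_injective,
    Function.Exact.inl_snd, LinearMap.snd_surjective⟩

/-- A short exact sequence with projective right end splits. -/
theorem SES.split {A B C : ModuleCat.{u} Λ} (h : SES A B C) [Module.Projective Λ C] :
    Nonempty (B ≃ₗ[Λ] A × C) := by
  obtain ⟨f, g, hf, hfg, hg⟩ := h
  obtain ⟨s, hs⟩ := Module.projective_lifting_property g LinearMap.id hg
  exact ⟨((lequivProdOfRightSplitExact hf hfg.linearMap_ker_eq.symm hs)).symm⟩

theorem pd_dsum_le {A B : ModuleCat.{u} Λ} {n : ℕ} (hA : pd A ≤ n) (hB : pd B ≤ n) :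
    pd (dsum A B) ≤ n :=
  (SES.dsum A B).pd_mid hA hB

/-! ### Direct summands. -/

theorem IsSummand.refl (M : ModuleCat.{u} Λ) : IsSummand M M :=
  ⟨ModuleCat.of Λ PUnit.{u + 1}, ⟨(LinearEquiv.prodUnique (R := Λ) (M := M) (M₂ := PUnit.{u + 1})).symm⟩⟩

theorem IsSummand.dsum_left (A B : ModuleCat.{u} Λ) : IsSummand A (dsum A B) :=
  ⟨B, ⟨LinearEquiv.refl Λ (A × B)⟩⟩

theorem IsSummand.dsum_right (A B : ModuleCat.{u} Λ) : IsSummand B (dsum A B) :=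
  ⟨A, ⟨LinearEquiv.prodComm Λ A B⟩⟩

theorem IsSummand.trans {A B C : ModuleCat.{u} Λ} (h : IsSummand A B) (h' : IsSummand B C) :
    IsSummand A C := by
  obtain ⟨X, ⟨e⟩⟩ := h
  obtain ⟨Y, ⟨e'⟩⟩ := h'
  exact ⟨dsum X Y, ⟨e' ≪≫ₗ (e.prodCongr (LinearEquiv.refl Λ Y)) ≪≫ₗ LinearEquiv.prodAssoc Λ A X Y⟩⟩

theorem IsSummand.of_equiv {A B : ModuleCat.{u} Λ} (e : A ≃ₗ[Λ] B) : IsSummand A B := by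
  obtain ⟨Y, ⟨i⟩⟩ := IsSummand.refl B
  exact ⟨Y, ⟨i ≪≫ₗ (e.symm.prodCongr (LinearEquiv.refl Λ Y))⟩⟩

theorem IsSummand.finite {A B : ModuleCat.{u} Λ} [Module.Finite Λ B] (h : IsSummand A B) :
    Module.Finite Λ A := by
  obtain ⟨Y, ⟨e⟩⟩ := h
  exact Module.Finite.of_surjective (LinearMap.fst Λ A Y ∘ₗ e.toLinearMap)
    ((LinearMap.fst_surjective (R := Λ) (M := A) (M₂ := Y)).comp e.surjective)

theorem IsSummand.projective {A B : ModuleCat.{u} Λ} [Module.Projective Λ B] (h : IsSummand A B) :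
    Module.Projective Λ A := by
  rw [← pd_le_zero_iff]
  exact (pd_le_of_summand h).trans (pd_eq_zero B).le

/-- A module is a direct summand if it is a retract. -/
theorem IsSummand.of_retract {A B : ModuleCat.{u} Λ} (i : A →ₗ[Λ] B) (r : B →ₗ[Λ] A)
    (h : ∀ a, r (i a) = a) : IsSummand A B := by
  refine ⟨ModuleCat.of Λ (LinearMap.ker r), ⟨?_⟩⟩
  exact LinearEquiv.symm <| (LinearEquiv.prodComm Λ A (LinearMap.ker r)) ≪≫ₗ
    lequivProdOfRightSplitExact (j := (LinearMap.ker r).subtype) (g := r) (f := i)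
    (Submodule.injective_subtype _) (by simp) (by ext a; simp [h])

instance (A B : ModuleCat.{u} Λ) [Module.Finite Λ A] [Module.Finite Λ B] :
    Module.Finite Λ (dsum A B) := inferInstanceAs (Module.Finite Λ (A × B))

instance (A B : ModuleCat.{u} Λ) [Module.Projective Λ A] [Module.Projective Λ B] :
    Module.Projective Λ (dsum A B) := inferInstanceAs (Module.Projective Λ (A × B))

/-! ### Syzygies -/

section Syzygies

theorem syzPow_zero (M : ModuleCat.{u} Λ) : syzPow 0 M = M := rfl

theorem syzPow_succ (n : ℕ) (M : ModuleCat.{u} Λ) : syzPow (n + 1) M = syz (syzPow n M) :=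
  Function.iterate_succ_apply' _ _ _

theorem syzPow_add (m n : ℕ) (M : ModuleCat.{u} Λ) :
    syzPow (m + n) M = syzPow m (syzPow n M) :=
  Function.iterate_add_apply _ _ _ _

variable [IsArtinianRing Λ]

theorem SES.syz (M : ModuleCat.{u} Λ) [Module.Finite Λ M] :
    ∃ P : ModuleCat.{u} Λ, Module.Finite Λ P ∧ Module.Projective Λ P ∧ SES (syz M) P M := by
  obtain ⟨P, f, hf⟩ := exists_isProjCover M
  obtain ⟨e⟩ := syz_equiv_ker hf
  refine ⟨P, hf.finite, hf.projective, (LinearMap.ker f).subtype ∘ₗ e.toLinearMap, f,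
    (Submodule.injective_subtype _).comp e.injective, ?_, hf.surjective⟩
  intro x
  constructor
  · intro h
    exact ⟨e.symm ⟨x, h⟩, by simp⟩
  · rintro ⟨y, rfl⟩
    exact (e y).2

instance (M : ModuleCat.{u} Λ) [Module.Finite Λ M] : Module.Finite Λ (syz M) := finite_syz M

instance finite_syzPow (n : ℕ) (M : ModuleCat.{u} Λ) [Module.Finite Λ M] :
    Module.Finite Λ (syzPow n M) := by
  induction n with
  | zero => rwa [syzPow_zero]
  | succ n ih => rw [syzPow_succ]; infer_instance

theorem syz_equiv {M N : ModuleCat.{u} Λ} [Module.Finite Λ N] (e : M ≃ₗ[Λ] N) :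
    Nonempty (syz M ≃ₗ[Λ] syz N) := by
  have := Module.Finite.equiv e.symm
  obtain ⟨P, f, hf⟩ := exists_isProjCover M
  obtain ⟨P', f', hf'⟩ := exists_isProjCover N
  obtain ⟨i⟩ := syz_equiv_ker hf
  obtain ⟨i'⟩ := syz_equiv_ker hf'
  obtain ⟨j⟩ := hf.ker_equiv hf' e
  exact ⟨i ≪≫ₗ j ≪≫ₗ i'.symm⟩

theorem syz_dsum (A B : ModuleCat.{u} Λ) [Module.Finite Λ A] [Module.Finite Λ B] :
    Nonempty (syz (dsum A B) ≃ₗ[Λ] dsum (syz A) (syz B)) :=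
  syz_equiv_prod (LinearEquiv.refl Λ (A × B))

theorem syz_dsum_projective (A P : ModuleCat.{u} Λ) [Module.Finite Λ A] [Module.Finite Λ P]
    [Module.Projective Λ P] : Nonempty (syz (dsum A P) ≃ₗ[Λ] syz A) := by
  obtain ⟨e⟩ := syz_dsum A P
  have : Subsingleton (syz P) := subsingleton_syz_of_projective
  have : Unique (syz P) := uniqueOfSubsingleton 0
  exact ⟨e ≪≫ₗ LinearEquiv.prodUnique (R := Λ) (M := syz A) (M₂ := syz P)⟩

theorem syzPow_equiv {M N : ModuleCat.{u} Λ} [Module.Finite Λ N] (n : ℕ) (e : M ≃ₗ[Λ] N) :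
    Nonempty (syzPow n M ≃ₗ[Λ] syzPow n N) := by
  induction n with
  | zero => exact ⟨e⟩
  | succ n ih =>
    obtain ⟨i⟩ := ih
    rw [syzPow_succ, syzPow_succ]
    exact syz_equiv i

theorem syzPow_dsum (n : ℕ) (A B : ModuleCat.{u} Λ) [Module.Finite Λ A] [Module.Finite Λ B] :
    Nonempty (syzPow n (dsum A B) ≃ₗ[Λ] dsum (syzPow n A) (syzPow n B)) := by
  induction n with
  | zero => exact ⟨LinearEquiv.refl _ _⟩
  | succ n ih =>
    obtain ⟨i⟩ := ih
    obtain ⟨j⟩ := syz_equiv i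
    obtain ⟨k⟩ := syz_dsum (syzPow n A) (syzPow n B)
    rw [syzPow_succ, syzPow_succ, syzPow_succ]
    exact ⟨j ≪≫ₗ k⟩

theorem IsSummand.syzPow {X M : ModuleCat.{u} Λ} [Module.Finite Λ M] (h : IsSummand X M) (n : ℕ) :
    IsSummand (syzPow n X) (syzPow n M) := by
  have := h.finite
  obtain ⟨Y, ⟨e⟩⟩ := h
  have : Module.Finite Λ Y := IsSummand.finite (B := M) ⟨X, ⟨e ≪≫ₗ LinearEquiv.prodComm Λ X Y⟩⟩
  obtain ⟨i⟩ := syzPow_equiv (N := dsum X Y) n e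
  obtain ⟨j⟩ := syzPow_dsum n X Y
  exact ⟨FinDim.syzPow n Y, ⟨i ≪≫ₗ j⟩⟩

theorem pd_syz_le {M : ModuleCat.{u} Λ} [Module.Finite Λ M] {n : ℕ} (h : pd M ≤ (n + 1 : ℕ)) :
    pd (syz M) ≤ n := by
  obtain ⟨P, _, _, hP⟩ := SES.syz M
  exact hP.pd_left ((pd_eq_zero P).trans_le bot_le) h

theorem pd_le_pd_syz {M : ModuleCat.{u} Λ} [Module.Finite Λ M] {n : ℕ} (h : pd (syz M) ≤ n) :
    pd M ≤ (n + 1 : ℕ) := by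
  obtain ⟨P, _, _, hP⟩ := SES.syz M
  exact hP.pd_right h ((pd_eq_zero P).trans_le bot_le)

theorem projective_syzPow {M : ModuleCat.{u} Λ} [Module.Finite Λ M] {n : ℕ} (h : pd M ≤ n) :
    Module.Projective Λ (syzPow n M) := by
  induction n generalizing M with
  | zero => exact (pd_le_zero_iff M).1 h
  | succ n ih => rw [syzPow_add]; exact ih (pd_syz_le h)

instance projective_syzPow_of_projective {M : ModuleCat.{u} Λ} [Module.Finite Λ M]
    [Module.Projective Λ M] {n : ℕ} : Module.Projective Λ (syzPow n M) :=
  projective_syzPow ((pd_eq_zero M).trans_le bot_le)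

theorem pd_le_pd_syzPow {M : ModuleCat.{u} Λ} [Module.Finite Λ M] (n : ℕ) :
    pd M ≤ n + pd (syzPow n M) := by
  rcases eq_or_ne (pd (syzPow n M)) ⊤ with h | h
  · simp [h]
  obtain ⟨k, hk⟩ := ENat.ne_top_iff_exists.1 h
  rw [← hk]
  replace hk := hk.ge
  norm_cast
  induction n generalizing k with
  | zero => simpa [syzPow_zero] using hk
  | succ n ih =>
    rw [syzPow_succ] at hk
    have := pd_le_pd_syz hk
    have := ih (ne_of_lt (this.trans_lt (ENat.natCast_lt_top _))) _ this
    rwa [add_right_comm n 1 k]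

theorem pd_syzPow_lt_top {M : ModuleCat.{u} Λ} [Module.Finite Λ M] (n : ℕ) (h : pd M < ⊤) :
    pd (syzPow n M) < ⊤ := by
  induction n with
  | zero => exact h
  | succ n ih =>
    obtain ⟨k, hk⟩ := (pd_lt_top_iff _).1 ih
    rw [syzPow_succ]
    exact (pd_lt_top_iff _).2 ⟨k, pd_syz_le (hk.trans (by norm_cast; omega))⟩

/-- Rotation of a short exact sequence. -/
theorem SES.rotate {A B C : ModuleCat.{u} Λ} [Module.Finite Λ C] (h : SES A B C) :
    ∃ P : ModuleCat.{u} Λ, Module.Finite Λ P ∧ Module.Projective Λ P ∧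
      SES (FinDim.syz C) (FinDim.dsum A P) B := by
  obtain ⟨f, g, hf, hfg, hg⟩ := h
  obtain ⟨P, hP, hP', i, q, hi, hiq, hq⟩ := SES.syz C
  obtain ⟨l, hl⟩ := Module.projective_lifting_property g q hg
  have hl' : ∀ p, g (l p) = q p := fun p => LinearMap.congr_fun hl p
  have hli : ∀ k, ∃ a, f a = l (i k) := fun k =>
    (hfg _).1 (by rw [hl', hiq.apply_apply_eq_zero])
  let F : A ≃ₗ[Λ] LinearMap.range f := LinearEquiv.ofInjective f hf
  -- On `Ω C` the lift `l` lands in `ker g = A`; `r` is the induced map. The kernel of `(f, l) : A ⊕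
  -- P → B` is then the image of `Ω C` under `(-r, i)`.
  let r : FinDim.syz C →ₗ[Λ] A := F.symm.toLinearMap ∘ₗ (l ∘ₗ i).codRestrict (LinearMap.range f) hli
  have hr : ∀ k, f (r k) = l (i k) := fun k =>
    congrArg Subtype.val (F.apply_symm_apply ⟨l (i k), hli k⟩)
  refine ⟨P, hP, hP', (LinearMap.prod (-r) i : _ →ₗ[Λ] A × P),
    (LinearMap.coprod f l : A × P →ₗ[Λ] B), ?_, ?_, ?_⟩
  · intro a b hab
    exact hi (congrArg Prod.snd hab)
  · rintro ⟨a, p⟩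
    constructor
    · intro h
      have h : f a + l p = 0 := h
      have : q p = 0 := by
        rw [← hl', eq_neg_of_add_eq_zero_right h, map_neg, hfg.apply_apply_eq_zero, neg_zero]
      obtain ⟨k, rfl⟩ := (hiq _).1 this
      refine ⟨k, Prod.ext (hf ?_) rfl⟩
      change f (- r k) = f a
      rw [map_neg, hr, eq_neg_of_add_eq_zero_left h]
    · rintro ⟨k, hk⟩
      obtain rfl : - r k = a := congrArg Prod.fst hk
      obtain rfl : i k = p := congrArg Prod.snd hk
      change f (- r k) + l (i k) = 0
      rw [map_neg, hr, neg_add_cancel]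
  · intro b
    obtain ⟨p, hp⟩ := hq (g b)
    obtain ⟨a, ha⟩ := (hfg (b - l p)).1 (by rw [map_sub, hl', hp, sub_self])
    exact ⟨(a, p), by change f a + l p = b; rw [ha, sub_add_cancel]⟩

/-- The horseshoe lemma, with a projective summand in the last term. -/
theorem SES.horseshoe {A B C : ModuleCat.{u} Λ} [Module.Finite Λ A] [Module.Finite Λ B]
    [Module.Finite Λ C] (h : SES A B C) :
    ∃ P Q : ModuleCat.{u} Λ, Module.Finite Λ P ∧ Module.Projective Λ P ∧ Module.Finite Λ Q ∧
      Module.Projective Λ Q ∧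
      SES (FinDim.syz A) (FinDim.dsum (FinDim.syz B) P) (FinDim.dsum (FinDim.syz C) Q) := by
  -- Three rotations replace the triple `A, B, C` by `Ω(A ⊕ P), Ω B ⊕ R, Ω C ⊕ Q`, and `Ω` does not
  -- see the projective summand `P`.
  obtain ⟨P, _, _, h⟩ := h.rotate
  obtain ⟨Q, hQ, hQ', h⟩ := h.rotate
  obtain ⟨R, hR, hR', h⟩ := h.rotate
  obtain ⟨e⟩ := syz_dsum_projective A P
  exact ⟨R, Q, hR, hR', hQ, hQ', h.congr e (LinearEquiv.refl _ _) (LinearEquiv.refl _ _)⟩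

theorem SES.syzPow {A B C : ModuleCat.{u} Λ} [Module.Finite Λ A] [Module.Finite Λ B]
    [Module.Finite Λ C] (h : SES A B C) (n : ℕ) :
    ∃ P Q : ModuleCat.{u} Λ, Module.Finite Λ P ∧ Module.Projective Λ P ∧ Module.Finite Λ Q ∧
      Module.Projective Λ Q ∧ SES (FinDim.syzPow n A) (FinDim.dsum (FinDim.syzPow n B) P)
        (FinDim.dsum (FinDim.syzPow n C) Q) := by
  induction n with
  | zero =>
    have hf : Module.Finite Λ (ModuleCat.of Λ PUnit.{u + 1}) :=
      inferInstanceAs (Module.Finite Λ PUnit.{u + 1})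
    have hp : Module.Projective Λ (ModuleCat.of Λ PUnit.{u + 1}) :=
      inferInstanceAs (Module.Projective Λ PUnit.{u + 1})
    refine ⟨ModuleCat.of Λ PUnit.{u + 1}, ModuleCat.of Λ PUnit.{u + 1}, hf, hp, hf, hp, ?_⟩
    exact h.congr (LinearEquiv.refl _ _)
      (LinearEquiv.prodUnique (R := Λ) (M := B) (M₂ := PUnit.{u + 1})).symm
      (LinearEquiv.prodUnique (R := Λ) (M := C) (M₂ := PUnit.{u + 1})).symm
  | succ n ih =>
    obtain ⟨P, Q, _, _, _, _, h⟩ := ih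
    obtain ⟨P', Q', hP, hP', hQ, hQ', h⟩ := h.horseshoe
    obtain ⟨e⟩ := syz_dsum_projective (FinDim.syzPow n B) P
    obtain ⟨i⟩ := syz_dsum_projective (FinDim.syzPow n C) Q
    refine ⟨P', Q', hP, hP', hQ, hQ', ?_⟩
    rw [syzPow_succ, syzPow_succ, syzPow_succ]
    exact h.congr (LinearEquiv.refl _ _) (e.prodCongr (LinearEquiv.refl _ _))
      (i.prodCongr (LinearEquiv.refl _ _))

end Syzygies

/-! ### Indecomposable modules -/

theorem indecomposable_iff (X : ModuleCat.{u} Λ) :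
    Indecomposable X ↔ Nontrivial X ∧
      ∀ A B : ModuleCat.{u} Λ, (X ≃ₗ[Λ] A × B) → Subsingleton A ∨ Subsingleton B := by
  simp only [Indecomposable, ModuleCat.isZero_iff_subsingleton, not_subsingleton_iff_nontrivial]
  refine and_congr_right fun _ => forall₂_congr fun A B => ?_
  exact ⟨fun h e => h (e.toModuleIso (X₂ := dsum A B) ≪≫ (ModuleCat.biprodIsoProd A B).symm),
    fun h e => h (e ≪≫ ModuleCat.biprodIsoProd A B).toLinearEquiv⟩

theorem IsSummand.exists_retract {X M : ModuleCat.{u} Λ} (h : IsSummand X M) :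
    ∃ (i : X →ₗ[Λ] M) (r : M →ₗ[Λ] X), ∀ x, r (i x) = x := by
  obtain ⟨Y, ⟨e⟩⟩ := h
  exact ⟨e.symm.toLinearMap ∘ₗ LinearMap.inl Λ X Y, LinearMap.fst Λ X Y ∘ₗ e.toLinearMap,
    fun x => by simp⟩

theorem IsSummand.subsingleton {X M : ModuleCat.{u} Λ} [Subsingleton M] (h : IsSummand X M) :
    Subsingleton X := by
  obtain ⟨i, r, h⟩ := h.exists_retract
  exact ⟨fun a b => by rw [← h a, ← h b, Subsingleton.elim (i a) (i b)]⟩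

/-- A nonzero direct summand of an indecomposable module is the whole module. -/
theorem IsSummand.equiv_of_indecomposable {X M : ModuleCat.{u} Λ} (h : IsSummand X M)
    (hM : Indecomposable M) [Nontrivial X] : Nonempty (X ≃ₗ[Λ] M) := by
  obtain ⟨Y, ⟨e⟩⟩ := h
  rcases ((indecomposable_iff M).1 hM).2 X Y e with h | h
  · exact absurd h (not_subsingleton X)
  · have : Unique Y := uniqueOfSubsingleton 0
    exact ⟨(e ≪≫ₗ LinearEquiv.prodUnique (R := Λ) (M := X) (M₂ := Y)).symm⟩

/-- Schur complement: if `e` has blocks `a, b, c, d` with `d` invertible, then `a - b d⁻¹ c` is an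
isomorphism `X → Y`, and its inverse is the upper left block of `e⁻¹`. -/
theorem equiv_of_isUnit_corner {X Y Z : ModuleCat.{u} Λ} (e : (X × Z) ≃ₗ[Λ] (Y × Z))
    (h : IsUnit (LinearMap.snd Λ Y Z ∘ₗ e.toLinearMap ∘ₗ LinearMap.inr Λ X Z : Module.End Λ Z)) :
    Nonempty (X ≃ₗ[Λ] Y) := by
  obtain ⟨u, hu⟩ := h
  let v : Module.End Λ Z := ↑u⁻¹
  have hu' : ∀ z, (e (0, z)).2 = (u : Module.End Λ Z) z := fun z => by rw [hu]; rfl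
  have hv : ∀ z, v ((e (0, z)).2) = z := fun z => by
    rw [hu', ← Module.End.mul_apply, Units.inv_mul, Module.End.one_apply]
  have hv' : ∀ z, (e (0, v z)).2 = z := fun z => by
    rw [hu', ← Module.End.mul_apply, Units.mul_inv, Module.End.one_apply]
  let F : X →ₗ[Λ] Y := LinearMap.fst Λ Y Z ∘ₗ e.toLinearMap ∘ₗ LinearMap.inl Λ X Z -
    LinearMap.fst Λ Y Z ∘ₗ e.toLinearMap ∘ₗ LinearMap.inr Λ X Z ∘ₗ v ∘ₗ
      LinearMap.snd Λ Y Z ∘ₗ e.toLinearMap ∘ₗ LinearMap.inl Λ X Z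
  let G : Y →ₗ[Λ] X := LinearMap.fst Λ X Z ∘ₗ e.symm.toLinearMap ∘ₗ LinearMap.inl Λ Y Z
  -- `F x` is the first coordinate of `e (x, z)`, for the `z` which kills the second coordinate
  have hF : ∀ x, e (x, - v ((e (x, 0)).2)) = (F x, 0) := fun x => by
    have h1 : (x, - v ((e (x, 0)).2)) = (x, 0) - ((0 : X), v ((e (x, 0)).2)) := by simp
    rw [h1, map_sub]
    exact Prod.ext rfl (by simp [hv'])
  have hF' : ∀ x z y, e (x, z) = (y, 0) → F x = y := fun x z y h => by
    have h1 := hF x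
    have h2 : e (0, z + v ((e (x, 0)).2)) = (y - F x, 0) := by
      have : ((0 : X), z + v ((e (x, 0)).2)) = (x, z) - (x, - v ((e (x, 0)).2)) := by simp
      rw [this, map_sub, h, h1]
      simp
    have h3 := hv (z + v ((e (x, 0)).2))
    rw [h2, map_zero] at h3
    rw [← h3, Prod.mk_zero_zero, map_zero] at h2
    exact (sub_eq_zero.1 (congrArg Prod.fst h2).symm).symm
  refine ⟨LinearEquiv.ofLinearMap F G ?_ ?_⟩
  · ext y
    exact hF' _ (e.symm (y, 0)).2 _ (by simp [G])
  · ext x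
    change (e.symm (F x, 0)).1 = x
    rw [← hF, e.symm_apply_apply]

/-! ### Fitting's lemma and local endomorphism rings of indecomposable modules. -/

section Artinian

variable [IsArtinianRing Λ]

/-- Fitting's lemma. -/
theorem isUnit_or_isNilpotent_of_indecomposable {X : ModuleCat.{u} Λ} [Module.Finite Λ X]
    (hX : Indecomposable X) (f : Module.End Λ X) : IsUnit f ∨ IsNilpotent f := by
  obtain ⟨k, hk, hk1⟩ := (f.eventually_isCompl_ker_pow_range_pow.and
    (Filter.eventually_ge_atTop 1)).exists
  rcases ((indecomposable_iff X).1 hX).2 (ModuleCat.of Λ (LinearMap.ker (f ^ k)))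
    (ModuleCat.of Λ (LinearMap.range (f ^ k)))
    (Submodule.prodEquivOfIsCompl _ _ hk).symm with h | h
  · left
    have h1 : LinearMap.ker (f ^ k) = ⊥ := Submodule.subsingleton_iff_eq_bot.1 h
    have h2 : LinearMap.range (f ^ k) = ⊤ := by
      rw [← hk.sup_eq_top, h1, bot_sup_eq]
    refine (isUnit_pow_iff (by omega : k ≠ 0)).1 ((Module.End.isUnit_iff _).2
      ⟨LinearMap.ker_eq_bot.1 h1, LinearMap.range_eq_top.1 h2⟩)
  · right
    exact ⟨k, LinearMap.range_eq_bot.1 (Submodule.subsingleton_iff_eq_bot.1 h)⟩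

/-- Normalise the sum to `1`. If `u⁻¹ f` is not a unit it is nilpotent, and then `u⁻¹ g = 1 - u⁻¹ f`
is a unit: the endomorphism ring is local. -/
theorem isUnit_or_of_add_isUnit {X : ModuleCat.{u} Λ} [Module.Finite Λ X]
    (hX : Indecomposable X) {f g : Module.End Λ X} (h : IsUnit (f + g)) : IsUnit f ∨ IsUnit g := by
  obtain ⟨u, hu⟩ := h
  have h1 : (↑u⁻¹ * f) + (↑u⁻¹ * g) = 1 := by rw [← mul_add, ← hu, Units.inv_mul]
  rcases isUnit_or_isNilpotent_of_indecomposable hX (↑u⁻¹ * f) with h | h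
  · exact Or.inl ((Units.isUnit_units_mul _ _).1 h)
  · right
    rw [← Units.isUnit_units_mul u⁻¹, eq_sub_iff_add_eq'.2 h1]
    exact h.isUnit_one_sub

/-- An indecomposable direct summand of `A ⊕ B` is a direct summand of `A` or of `B`. -/
theorem IsSummand.of_dsum {X A B : ModuleCat.{u} Λ} [Module.Finite Λ X] (hX : Indecomposable X)
    (h : IsSummand X (dsum A B)) : IsSummand X A ∨ IsSummand X B := by
  obtain ⟨(i : X →ₗ[Λ] A × B), (r : A × B →ₗ[Λ] X), h⟩ := h.exists_retract
  let f : Module.End Λ X := r ∘ₗ LinearMap.inl Λ A B ∘ₗ LinearMap.fst Λ A B ∘ₗ i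
  let g : Module.End Λ X := r ∘ₗ LinearMap.inr Λ A B ∘ₗ LinearMap.snd Λ A B ∘ₗ i
  have hfg : f + g = 1 := by
    ext x
    change r ((i x).1, 0) + r (0, (i x).2) = x
    rw [← map_add, Prod.mk_add_mk, add_zero, zero_add]
    exact h x
  rcases isUnit_or_of_add_isUnit hX (hfg ▸ isUnit_one) with hu | hu
  · left
    obtain ⟨u, hu⟩ := hu
    refine IsSummand.of_retract (LinearMap.fst Λ A B ∘ₗ i)
      ((↑u⁻¹ : Module.End Λ X) ∘ₗ r ∘ₗ LinearMap.inl Λ A B) fun x => ?_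
    change (↑u⁻¹ : Module.End Λ X) (f x) = x
    rw [← hu, ← Module.End.mul_apply, Units.inv_mul, Module.End.one_apply]
  · right
    obtain ⟨u, hu⟩ := hu
    refine IsSummand.of_retract (LinearMap.snd Λ A B ∘ₗ i)
      ((↑u⁻¹ : Module.End Λ X) ∘ₗ r ∘ₗ LinearMap.inr Λ A B) fun x => ?_
    change (↑u⁻¹ : Module.End Λ X) (g x) = x
    rw [← hu, ← Module.End.mul_apply, Units.inv_mul, Module.End.one_apply]

/-- Every finitely generated module is built from indecomposable modules by forming direct sums. -/
theorem decomposition_induction {P : ModuleCat.{u} Λ → Prop}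
    (zero : ∀ A : ModuleCat.{u} Λ, Subsingleton A → P A)
    (indec : ∀ A : ModuleCat.{u} Λ, Module.Finite Λ A → Indecomposable A → P A)
    (prod : ∀ M A B : ModuleCat.{u} Λ, Module.Finite Λ M → Module.Finite Λ A → Module.Finite Λ B →
      (M ≃ₗ[Λ] A × B) → P A → P B → P M)
    (M : ModuleCat.{u} Λ) [hM : Module.Finite Λ M] : P M := by
  induction hl : Module.length Λ M using WellFoundedLT.induction generalizing M with
  | ind l ih =>
    rcases subsingleton_or_nontrivial M with h | hn
    · exact zero M h
    by_cases hi : Indecomposable M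
    · exact indec M hM hi
    rw [indecomposable_iff] at hi
    push Not at hi
    obtain ⟨A, B, e, hA, hB⟩ := hi hn
    have fA : Module.Finite Λ A := IsSummand.finite (B := M) ⟨B, ⟨e⟩⟩
    have fB : Module.Finite Λ B :=
      IsSummand.finite (B := M) ⟨A, ⟨e ≪≫ₗ LinearEquiv.prodComm Λ A B⟩⟩
    have hlen : Module.length Λ M = Module.length Λ A + Module.length Λ B := by
      rw [e.length_eq, Module.length_prod]
    have lA : Module.length Λ A ≠ ⊤ := Module.length_ne_top
    have lB : Module.length Λ B ≠ ⊤ := Module.length_ne_top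
    have pA : 0 < Module.length Λ A := Module.length_pos
    have pB : 0 < Module.length Λ B := Module.length_pos
    refine prod M A B hM fA fB e (ih _ ?_ A rfl) (ih _ ?_ B rfl)
    · rw [← hl, hlen, add_comm]
      exact ENat.lt_add_left lA pB
    · rw [← hl, hlen]
      exact ENat.lt_add_left lB pA

/-! ### Cancellation -/

theorem cancel_indecomposable {X Y Z : ModuleCat.{u} Λ} [Module.Finite Λ Z] (hZ : Indecomposable Z)
    (e : (X × Z) ≃ₗ[Λ] (Y × Z)) : Nonempty (X ≃ₗ[Λ] Y) := by
  let c : X →ₗ[Λ] Z := LinearMap.snd Λ Y Z ∘ₗ e.toLinearMap ∘ₗ LinearMap.inl Λ X Z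
  let d : Module.End Λ Z := LinearMap.snd Λ Y Z ∘ₗ e.toLinearMap ∘ₗ LinearMap.inr Λ X Z
  let b' : Z →ₗ[Λ] X := LinearMap.fst Λ X Z ∘ₗ e.symm.toLinearMap ∘ₗ LinearMap.inr Λ Y Z
  let d' : Module.End Λ Z := LinearMap.snd Λ X Z ∘ₗ e.symm.toLinearMap ∘ₗ LinearMap.inr Λ Y Z
  by_cases hd : IsUnit d
  · exact equiv_of_isUnit_corner e hd
  let cb : Module.End Λ Z := c ∘ₗ b'
  -- The lower right block of `e e⁻¹ = 1`. As `d` is not a unit, neither is `d * d'`, so locality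
  -- makes `cb` a unit.
  have hsum : cb + d * d' = 1 := by
    ext z
    change (e ((e.symm (0, z)).1, 0)).2 + (e (0, (e.symm (0, z)).2)).2 = z
    rw [← Prod.snd_add, ← map_add, Prod.mk_add_mk, add_zero, zero_add, Prod.mk.eta,
      e.apply_symm_apply]
  have hcb : IsUnit cb := by
    rcases isUnit_or_of_add_isUnit hZ (hsum ▸ isUnit_one) with h | h
    · exact h
    · refine absurd ((Module.End.isUnit_iff d).2
        (IsNoetherian.bijective_of_surjective_endomorphism d fun z => ?_)) hd
      obtain ⟨w, hw⟩ := ((Module.End.isUnit_iff _).1 h).2 z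
      exact ⟨d' w, hw⟩
  have hnil : IsUnit (cb + d) := by
    by_contra h
    have : IsUnit ((cb + d) + -d) := by rwa [add_neg_cancel_right]
    rcases isUnit_or_of_add_isUnit hZ this with h' | h'
    · exact h h'
    · exact hd ((IsUnit.neg_iff d).1 h')
  -- Composing `e` with this shear changes its lower right block from `d` to `cb + d`, which is a
  -- unit.
  let s : (X × Z) ≃ₗ[Λ] (X × Z) :=
    { toFun := fun p => (p.1 + b' p.2, p.2)
      invFun := fun p => (p.1 - b' p.2, p.2)
      map_add' := fun p q => by
        refine Prod.ext ?_ rfl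
        change p.1 + q.1 + b' (p.2 + q.2) = p.1 + b' p.2 + (q.1 + b' q.2)
        rw [map_add]; abel
      map_smul' := fun r p => by
        refine Prod.ext ?_ rfl
        change r • p.1 + b' (r • p.2) = r • (p.1 + b' p.2)
        rw [map_smul, smul_add]
      left_inv := fun p => by simp
      right_inv := fun p => by simp }
  refine equiv_of_isUnit_corner (s ≪≫ₗ e) ?_
  convert hnil
  ext z
  change (e (0 + b' z, z)).2 = (e (b' z, 0)).2 + (e (0, z)).2
  rw [← Prod.snd_add, ← map_add, Prod.mk_add_mk, zero_add, zero_add, add_zero]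

/-- Finitely generated modules over a left artinian ring can be cancelled in direct sums. -/
theorem cancel {X Y : ModuleCat.{u} Λ} (Z : ModuleCat.{u} Λ) [Module.Finite Λ Z]
    (e : (X × Z) ≃ₗ[Λ] (Y × Z)) : Nonempty (X ≃ₗ[Λ] Y) := by
  refine decomposition_induction (P := fun Z => ∀ X Y : ModuleCat.{u} Λ,
    ((X × Z) ≃ₗ[Λ] (Y × Z)) → Nonempty (X ≃ₗ[Λ] Y)) ?_ ?_ ?_ Z X Y e
  · intro Z _ X Y e
    have : Unique Z := uniqueOfSubsingleton 0
    exact ⟨LinearEquiv.prodUnique.symm ≪≫ₗ e ≪≫ₗ LinearEquiv.prodUnique⟩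
  · intro Z _ hZ X Y e
    exact cancel_indecomposable hZ e
  · intro Z A B _ _ _ i hA hB X Y e
    obtain ⟨j⟩ := hB (dsum X A) (dsum Y A) (LinearEquiv.prodAssoc Λ X A B ≪≫ₗ
      (LinearEquiv.refl Λ X).prodCongr i.symm ≪≫ₗ e ≪≫ₗ (LinearEquiv.refl Λ Y).prodCongr i ≪≫ₗ
      (LinearEquiv.prodAssoc Λ Y A B).symm)
    exact hA X Y j

end Artinian

/-! ### Domination: indecomposable summands up to projectives -/

/-- Every indecomposable direct summand of `V` is projective or a direct summand of `W`. -/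
def Dom (W V : ModuleCat.{u} Λ) : Prop :=
  ∀ X : ModuleCat.{u} Λ, Module.Finite Λ X → Indecomposable X → IsSummand X V →
    Module.Projective Λ X ∨ IsSummand X W

theorem Dom.trans {U V W : ModuleCat.{u} Λ} (h : Dom W V) (h' : Dom V U) : Dom W U :=
  fun X hX hXi hXs => (h' X hX hXi hXs).elim Or.inl (h X hX hXi)

theorem Dom.of_isSummand {V W : ModuleCat.{u} Λ} (h : IsSummand V W) : Dom W V :=
  fun _ _ _ hs => Or.inr (hs.trans h)

theorem Dom.of_projective (W V : ModuleCat.{u} Λ) [Module.Projective Λ V] : Dom W V :=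
  fun _ _ _ hs => Or.inl hs.projective

theorem Indecomposable.not_subsingleton {X : ModuleCat.{u} Λ} (h : Indecomposable X) :
    ¬ Subsingleton X := by
  have := ((indecomposable_iff X).1 h).1
  exact _root_.not_subsingleton X

theorem pd_le_sup {M A B : ModuleCat.{u} Λ} (e : M ≃ₗ[Λ] A × B) : pd M ≤ pd A ⊔ pd B := by
  rcases eq_or_ne (pd A ⊔ pd B) ⊤ with h | h
  · simp [h]
  obtain ⟨n, hn⟩ := ENat.ne_top_iff_exists.1 h
  rw [← hn, pd_congr (N := dsum A B) e]
  exact pd_dsum_le (hn ▸ le_sup_left) (hn ▸ le_sup_right)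

theorem pd_of_subsingleton (M : ModuleCat.{u} Λ) [Subsingleton M] : pd M = 0 :=
  have : Module.Projective Λ M := Module.Projective.of_basis (Module.Basis.empty (ι := PEmpty.{u + 1}) M)
  pd_eq_zero M

section Artinian

variable [IsArtinianRing Λ]

theorem Dom.prod {W M A B : ModuleCat.{u} Λ} (e : M ≃ₗ[Λ] A × B) (hA : Dom W A) (hB : Dom W B) :
    Dom W M := fun X hX hXi hXs =>
  (IsSummand.of_dsum hXi (hXs.trans (IsSummand.of_equiv (B := dsum A B) e))).elim
    (hA X hX hXi) (hB X hX hXi)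

theorem Dom.of_inAdd {L X : ModuleCat.{u} Λ} (h : InAdd L X) : Dom L X := by
  obtain ⟨n, h⟩ := h
  refine Dom.trans ?_ (Dom.of_isSummand h)
  clear h
  induction n with
  | zero =>
    intro Y _ hY hs
    have : Subsingleton (ModuleCat.of Λ (Fin 0 → L)) := inferInstanceAs (Subsingleton (Fin 0 → L))
    exact absurd hs.subsingleton (Indecomposable.not_subsingleton hY)
  | succ n ih =>
    exact Dom.prod (A := L) (B := ModuleCat.of Λ (Fin n → L))
      (Fin.consLinearEquiv Λ (fun _ : Fin (n + 1) => (L : Type u))).symm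
      (Dom.of_isSummand (IsSummand.refl L)) ih

/-- A property of finitely generated modules that is inherited by direct sums may be checked on
indecomposable direct summands. -/
theorem of_indecomposable_summands {P : ModuleCat.{u} Λ → Prop}
    (zero : ∀ A : ModuleCat.{u} Λ, Subsingleton A → P A)
    (prod : ∀ M A B : ModuleCat.{u} Λ, Module.Finite Λ M → Module.Finite Λ A → Module.Finite Λ B →
      (M ≃ₗ[Λ] A × B) → P A → P B → P M)
    (V : ModuleCat.{u} Λ) [Module.Finite Λ V]
    (h : ∀ X : ModuleCat.{u} Λ, Module.Finite Λ X → Indecomposable X → IsSummand X V → P X) :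
    P V := by
  refine decomposition_induction (P := fun V => (∀ X : ModuleCat.{u} Λ, Module.Finite Λ X →
    Indecomposable X → IsSummand X V → P X) → P V) ?_ ?_ ?_ V h
  · exact fun A hA _ => zero A hA
  · exact fun A hA hi h => h A hA hi (IsSummand.refl A)
  · intro M A B hM hA hB e ihA ihB h
    refine prod M A B hM hA hB e (ihA fun X hX hi hs => h X hX hi ?_)
      (ihB fun X hX hi hs => h X hX hi ?_)
    · exact hs.trans ⟨B, ⟨e⟩⟩
    · exact hs.trans ⟨A, ⟨e ≪≫ₗ LinearEquiv.prodComm Λ A B⟩⟩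

theorem Dom.syzPow_of {U V : ModuleCat.{u} Λ} (n : ℕ) [Module.Finite Λ V]
    (h : ∀ X : ModuleCat.{u} Λ, Module.Finite Λ X → Indecomposable X → IsSummand X V →
      Dom U (syzPow n X)) : Dom U (syzPow n V) := by
  refine of_indecomposable_summands (P := fun V => Dom U (syzPow n V)) ?_ ?_ V h
  · intro A hA
    have : Module.Projective Λ A :=
      Module.Projective.of_basis (Module.Basis.empty (ι := PEmpty.{u + 1}) A)
    have : Module.Finite Λ A := inferInstance
    exact Dom.of_projective _ _
  · intro M A B _ _ _ e hA hB
    obtain ⟨i⟩ := syzPow_equiv (N := dsum A B) n e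
    obtain ⟨j⟩ := syzPow_dsum n A B
    exact Dom.prod (i ≪≫ₗ j) hA hB

theorem Dom.syzPow {W V : ModuleCat.{u} Λ} [Module.Finite Λ W] [Module.Finite Λ V] (h : Dom W V)
    (n : ℕ) : Dom (syzPow n W) (syzPow n V) :=
  Dom.syzPow_of n fun X hX hi hs => by
    rcases h X hX hi hs with h | h
    · exact Dom.of_projective _ _
    · exact Dom.of_isSummand (h.syzPow n)

theorem pd_le_of_indecomposable_summands {V : ModuleCat.{u} Λ} [Module.Finite Λ V] {n : ℕ∞}
    (h : ∀ X : ModuleCat.{u} Λ, Module.Finite Λ X → Indecomposable X → IsSummand X V → pd X ≤ n) :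
    pd V ≤ n :=
  of_indecomposable_summands (P := fun V => pd V ≤ n)
    (fun A _ => (pd_of_subsingleton A).trans_le bot_le)
    (fun _ _ _ _ _ _ e hA hB => (pd_le_sup e).trans (sup_le hA hB)) V h

theorem Dom.pd_le {W V : ModuleCat.{u} Λ} [Module.Finite Λ V] (h : Dom W V) (hV : pd V < ⊤) :
    pd V ≤ finDimClass fun X => IsSummand X W := by
  refine pd_le_of_indecomposable_summands fun X hX hi hs => ?_
  rcases h X hX hi hs with h | h
  · exact (pd_eq_zero X).trans_le bot_le
  · exact le_iSup₂_of_le X ⟨h, (pd_le_of_summand hs).trans_lt hV⟩ le_rfl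

/-- An indecomposable summand of `A ⊕ B` is one of `A` or of `B`, so only finitely many
indecomposables occur up to isomorphism. The projective dimension of any summand is controlled by
those of its own indecomposable summands. -/
theorem finDimClass_isSummand_lt_top (V : ModuleCat.{u} Λ) [Module.Finite Λ V] :
    finDimClass (fun X => IsSummand X V) < ⊤ := by
  obtain ⟨n, hn⟩ : ∃ n : ℕ, ∀ X : ModuleCat.{u} Λ, Module.Finite Λ X → Indecomposable X →
      IsSummand X V → pd X < ⊤ → pd X ≤ n := by
    refine decomposition_induction (P := fun V => ∃ n : ℕ, ∀ X : ModuleCat.{u} Λ,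
      Module.Finite Λ X → Indecomposable X → IsSummand X V → pd X < ⊤ → pd X ≤ n) ?_ ?_ ?_ V
    · exact fun A hA => ⟨0, fun X hX hi hs =>
        absurd hs.subsingleton (Indecomposable.not_subsingleton hi)⟩
    · intro A hA hi
      refine ⟨(pd A).toNat, fun X hX hXi hs hpd => ?_⟩
      have := ((indecomposable_iff X).1 hXi).1
      obtain ⟨e⟩ := hs.equiv_of_indecomposable hi
      rw [pd_congr e] at hpd ⊢
      exact (ENat.natCast_toNat hpd.ne).ge
    · rintro M A B _ _ _ e ⟨a, ha⟩ ⟨b, hb⟩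
      refine ⟨max a b, fun X hX hi hs hpd => ?_⟩
      rcases IsSummand.of_dsum hi (hs.trans (IsSummand.of_equiv (B := dsum A B) e)) with h | h
      · exact (ha X hX hi h hpd).trans (by norm_cast; exact le_max_left _ _)
      · exact (hb X hX hi h hpd).trans (by norm_cast; exact le_max_right _ _)
  refine lt_of_le_of_lt (iSup₂_le fun X hX => ?_) (ENat.natCast_lt_top n)
  have := hX.1.finite
  exact pd_le_of_indecomposable_summands fun Y hY hi hs =>
    hn Y hY hi (hs.trans hX.1) ((pd_le_of_summand hs).trans_lt hX.2)

end Artinian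

/-! ### The group `K` -/

theorem cls_of_equiv_prod {A B C : FMod Λ} (e : C.1 ≃ₗ[Λ] A.1 × B.1) :
    cls C = cls A + cls B := by
  rw [← sub_eq_zero, ← sub_sub, cls, cls, cls, ← map_sub, ← map_sub, Submodule.mkQ_apply,
    Submodule.Quotient.mk_eq_zero]
  exact Submodule.subset_span (Or.inl ⟨A, B, C, ⟨e⟩, rfl⟩)

theorem cls_eq_zero (P : FMod Λ) (h : Module.Projective Λ P.1) : cls P = 0 := by
  rw [cls, Submodule.mkQ_apply, Submodule.Quotient.mk_eq_zero]
  exact Submodule.subset_span (Or.inr ⟨P, h, rfl⟩)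

theorem cls_of_subsingleton (P : FMod Λ) [Subsingleton P.1] : cls P = 0 :=
  cls_eq_zero P (Module.Projective.of_basis (Module.Basis.empty (ι := PEmpty.{u + 1}) P.1))

theorem cls_congr {A B : FMod Λ} (e : A.1 ≃ₗ[Λ] B.1) : cls A = cls B := by
  let Z : FMod Λ := ⟨ModuleCat.of Λ PUnit.{u + 1}, inferInstanceAs (Module.Finite Λ PUnit.{u + 1})⟩
  have : Subsingleton Z.1 := inferInstanceAs (Subsingleton PUnit)
  rw [cls_of_equiv_prod (A := B) (B := Z)
    (e ≪≫ₗ (LinearEquiv.prodUnique (R := Λ) (M := B.1) (M₂ := PUnit.{u + 1})).symm),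
    cls_of_subsingleton Z, add_zero]

theorem genK_mono_of_isSummand {A B : ModuleCat.{u} Λ} (h : IsSummand A B) : genK A ≤ genK B := by
  refine Submodule.span_mono ?_
  rintro _ ⟨X, hX, hs, rfl⟩
  exact ⟨X, hX, hs.trans h, rfl⟩

theorem Dom.genK_le {W V : ModuleCat.{u} Λ} (h : Dom W V) : genK V ≤ genK W := by
  refine Submodule.span_le.2 ?_
  rintro _ ⟨X, hX, hs, rfl⟩
  rcases h X.1 X.2 hX hs with h | h
  · rw [cls_eq_zero X h]
    exact zero_mem _
  · exact Submodule.subset_span ⟨X, hX, h, rfl⟩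

section Artinian

variable [IsArtinianRing Λ]

theorem cls_mem_genK (M : FMod Λ) : cls M ∈ genK M.1 := by
  obtain ⟨M, hM⟩ := M
  refine decomposition_induction (P := fun M => ∀ h, cls ⟨M, h⟩ ∈ genK M) ?_ ?_ ?_ M hM
  · intro A hA h
    rw [cls_of_subsingleton]
    exact zero_mem _
  · intro A _ hA h
    exact Submodule.subset_span ⟨⟨A, h⟩, hA, IsSummand.refl A, rfl⟩
  · intro M A B _ fA fB e hA hB h
    rw [cls_of_equiv_prod (A := ⟨A, fA⟩) (B := ⟨B, fB⟩) e]
    exact add_mem (genK_mono_of_isSummand ⟨B, ⟨e⟩⟩ (hA fA))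
      (genK_mono_of_isSummand ⟨A, ⟨e ≪≫ₗ LinearEquiv.prodComm Λ A B⟩⟩ (hB fB))

/-- Decomposing `M` into finitely many indecomposables places `⟨M⟩` inside a finitely generated
subgroup, which suffices because `ℤ` is noetherian. -/
theorem genK_fg (M : ModuleCat.{u} Λ) [Module.Finite Λ M] : (genK M).FG := by
  suffices h : ∃ N : Submodule ℤ (GrK Λ), N.FG ∧ genK M ≤ N by
    obtain ⟨N, hN, h⟩ := h
    exact Submodule.FG.of_le hN h
  refine decomposition_induction
    (P := fun M => ∃ N : Submodule ℤ (GrK Λ), N.FG ∧ genK M ≤ N) ?_ ?_ ?_ M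
  · intro A hA
    refine ⟨⊥, Submodule.fg_bot, Submodule.span_le.2 ?_⟩
    rintro _ ⟨X, hX, hs, rfl⟩
    exact absurd hs.subsingleton (Indecomposable.not_subsingleton hX)
  · intro A fA hA
    refine ⟨Submodule.span ℤ {cls ⟨A, fA⟩}, Submodule.fg_span_singleton _,
      Submodule.span_mono ?_⟩
    rintro _ ⟨X, hX, hs, rfl⟩
    have := ((indecomposable_iff X.1).1 hX).1
    obtain ⟨e⟩ := hs.equiv_of_indecomposable hA
    exact cls_congr (B := ⟨A, fA⟩) e
  · rintro M A B _ _ _ e ⟨N, hN, hA⟩ ⟨N', hN', hB⟩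
    refine ⟨N ⊔ N', hN.sup hN', Submodule.span_le.2 ?_⟩
    rintro _ ⟨X, hX, hs, rfl⟩
    have := X.2
    rcases IsSummand.of_dsum hX (hs.trans (IsSummand.of_equiv (B := dsum A B) e)) with h | h
    · exact Submodule.mem_sup_left (hA (Submodule.subset_span ⟨X, hX, h, rfl⟩))
    · exact Submodule.mem_sup_right (hB (Submodule.subset_span ⟨X, hX, h, rfl⟩))

theorem omegaK_pow_cls (n : ℕ) (M : FMod Λ) :
    (omegaK Λ ^ n) (cls M) = cls ⟨syzPow n M.1, haveI := M.2; finite_syzPow n M.1⟩ := by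
  induction n with
  | zero => rfl
  | succ n ih =>
    rw [pow_succ', Module.End.mul_apply, ih, omegaK_cls]
    congr 1
    exact Subtype.ext (syzPow_succ n M.1).symm

end Artinian

/-! ### Equality in `K` is stable isomorphism -/

variable (Λ) in
/-- Isomorphism of finitely generated modules. -/
def isoSetoid : Setoid (FMod Λ) where
  r A B := Nonempty (A.1 ≃ₗ[Λ] B.1)
  iseqv := ⟨fun _ => ⟨LinearEquiv.refl _ _⟩, fun ⟨e⟩ => ⟨e.symm⟩, fun ⟨e⟩ ⟨f⟩ => ⟨e ≪≫ₗ f⟩⟩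

variable (Λ) in
/-- The isomorphism classes of finitely generated modules. -/
def IsoClass := Quotient (isoSetoid Λ)

/-- The isomorphism class of a module. -/
def isoClass (M : FMod Λ) : IsoClass Λ := Quotient.mk (isoSetoid Λ) M

/-- The direct sum of finitely generated modules. -/
def dsumF (A B : FMod Λ) : FMod Λ :=
  ⟨dsum A.1 B.1, haveI := A.2; haveI := B.2; inferInstanceAs (Module.Finite Λ (A.1 × B.1))⟩

instance : Add (IsoClass Λ) :=
  ⟨Quotient.map₂ dsumF fun _ _ ⟨e⟩ _ _ ⟨f⟩ => ⟨e.prodCongr f⟩⟩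

instance : Zero (IsoClass Λ) :=
  ⟨isoClass ⟨ModuleCat.of Λ PUnit.{u + 1}, inferInstanceAs (Module.Finite Λ PUnit.{u + 1})⟩⟩

theorem isoClass_dsumF (A B : FMod Λ) : isoClass (dsumF A B) = isoClass A + isoClass B := rfl

theorem isoClass_eq_iff {A B : FMod Λ} : isoClass A = isoClass B ↔ Nonempty (A.1 ≃ₗ[Λ] B.1) :=
  Quotient.eq (r := isoSetoid Λ)

theorem IsoClass.add_comm' (a b : IsoClass Λ) : a + b = b + a := by
  induction a using Quotient.inductionOn with | h A =>
  induction b using Quotient.inductionOn with | h B =>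
  exact Quotient.sound ⟨LinearEquiv.prodComm Λ A.1 B.1⟩

theorem IsoClass.zero_add' (a : IsoClass Λ) : 0 + a = a := by
  induction a using Quotient.inductionOn with | h A =>
  exact Quotient.sound ⟨LinearEquiv.uniqueProd (R := Λ) (M := A.1) (M₂ := PUnit.{u + 1})⟩

instance : AddCommMonoid (IsoClass Λ) where
  add_assoc a b c := by
    induction a using Quotient.inductionOn with | h A =>
    induction b using Quotient.inductionOn with | h B =>
    induction c using Quotient.inductionOn with | h C =>
    exact Quotient.sound ⟨LinearEquiv.prodAssoc Λ A.1 B.1 C.1⟩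
  zero_add := IsoClass.zero_add'
  add_zero a := by rw [IsoClass.add_comm', IsoClass.zero_add']
  add_comm := IsoClass.add_comm'
  nsmul := nsmulRec

/-- The class of a module in the split Grothendieck group. -/
def splitClass (M : FMod Λ) : Algebra.GrothendieckAddGroup (IsoClass Λ) :=
  Algebra.GrothendieckAddGroup.of (isoClass M)

theorem splitClass_dsumF (A B : FMod Λ) :
    splitClass (dsumF A B) = splitClass A + splitClass B := by
  rw [splitClass, isoClass_dsumF, map_add]; rfl

/-- The additivity relations vanish in the split Grothendieck group, so only differences of
projectives survive from `relK`. -/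
theorem exists_of_mem_relK {x : FMod Λ →₀ ℤ} (hx : x ∈ relK Λ) :
    ∃ P Q : FMod Λ, Module.Projective Λ P.1 ∧ Module.Projective Λ Q.1 ∧
      Finsupp.linearCombination ℤ splitClass x = splitClass P - splitClass Q := by
  let Z : FMod Λ := ⟨ModuleCat.of Λ PUnit.{u + 1}, inferInstanceAs (Module.Finite Λ PUnit.{u + 1})⟩
  have hZ : Module.Projective Λ Z.1 := inferInstanceAs (Module.Projective Λ PUnit.{u + 1})
  have hZ0 : splitClass Z = 0 := map_zero _
  rw [relK, ← Submodule.mem_toAddSubgroup, Submodule.span_int_eq_addSubgroupClosure] at hx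
  induction hx using AddSubgroup.closure_induction with
  | mem x hx =>
    rcases hx with ⟨A, B, C, ⟨e⟩, rfl⟩ | ⟨P, hP, rfl⟩
    · refine ⟨Z, Z, hZ, hZ, ?_⟩
      have : splitClass C = splitClass (dsumF A B) :=
        congrArg Algebra.GrothendieckAddGroup.of (isoClass_eq_iff.2 ⟨e⟩)
      rw [map_sub, map_sub]
      simp [this, splitClass_dsumF]
    · exact ⟨P, Z, hP, hZ, by simp [hZ0]⟩
  | zero => exact ⟨Z, Z, hZ, hZ, by simp⟩
  | add x y _ _ hx hy =>
    obtain ⟨P, Q, hP, hQ, h⟩ := hx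
    obtain ⟨P', Q', hP', hQ', h'⟩ := hy
    refine ⟨dsumF P P', dsumF Q Q', inferInstanceAs (Module.Projective Λ (P.1 × P'.1)),
      inferInstanceAs (Module.Projective Λ (Q.1 × Q'.1)), ?_⟩
    rw [map_add, h, h', splitClass_dsumF, splitClass_dsumF]
    abel
  | neg x _ hx =>
    obtain ⟨P, Q, hP, hQ, h⟩ := hx
    exact ⟨Q, P, hQ, hP, by rw [map_neg, h, neg_sub]⟩

theorem stable_equiv_of_cls_eq [IsArtinianRing Λ] {A B : FMod Λ} (h : cls A = cls B) :
    ∃ P Q : FMod Λ, Module.Projective Λ P.1 ∧ Module.Projective Λ Q.1 ∧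
      Nonempty (dsum A.1 P.1 ≃ₗ[Λ] dsum B.1 Q.1) := by
  rw [cls, cls, ← sub_eq_zero, ← map_sub, Submodule.mkQ_apply, Submodule.Quotient.mk_eq_zero] at h
  obtain ⟨P, Q, hP, hQ, h⟩ := exists_of_mem_relK h
  refine ⟨Q, P, hQ, hP, ?_⟩
  simp only [map_sub, Finsupp.linearCombination_single, one_smul] at h
  rw [sub_eq_sub_iff_add_eq_add, ← splitClass_dsumF, add_comm, ← splitClass_dsumF] at h
  -- Equality in the Grothendieck group is isomorphism after adding some common `C`, which is then
  -- cancelled.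
  obtain ⟨⟨c, _⟩, hc⟩ := (AddLocalization.addMonoidOf ⊤).eq_iff_exists.1 h
  obtain ⟨C, rfl⟩ := Quotient.exists_rep c
  obtain ⟨e⟩ := (isoClass_eq_iff (A := dsumF C (dsumF A Q)) (B := dsumF C (dsumF B P))).1 hc
  have := C.2
  obtain ⟨i⟩ := cancel C.1 (X := dsum A.1 Q.1) (Y := dsum B.1 P.1)
    (LinearEquiv.prodComm Λ _ _ ≪≫ₗ e ≪≫ₗ LinearEquiv.prodComm Λ _ _)
  exact ⟨i⟩

/-! ### Igusa–Todorov functions -/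

section Artinian

variable [IsArtinianRing Λ]

/-- The property defining `Φ(M)`. -/
def PhiStable (M : ModuleCat.{u} Λ) (n : ℕ) : Prop :=
  ∀ m ≥ n, Set.BijOn (omegaK Λ) ((genK M).map (omegaK Λ ^ m)) ((genK M).map (omegaK Λ ^ (m + 1)))

/-- `Ω` always maps `Ω^m ⟨M⟩` onto `Ω^(m+1) ⟨M⟩`, so only injectivity is at stake. -/
theorem phiStable_iff {M : ModuleCat.{u} Λ} {n : ℕ} :
    PhiStable M n ↔
      ∀ m ≥ n, ∀ x ∈ genK M, (omegaK Λ ^ (m + 1)) x = 0 → (omegaK Λ ^ m) x = 0 := by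
  refine forall₂_congr fun m _ => ?_
  constructor
  · intro h x hx h0
    refine h.injOn ⟨x, hx, rfl⟩ (zero_mem _) ?_
    rw [map_zero, ← Module.End.mul_apply, ← pow_succ', h0]
  · intro h
    refine ⟨?_, ?_, ?_⟩
    · rintro _ ⟨x, hx, rfl⟩
      exact ⟨x, hx, by rw [pow_succ', Module.End.mul_apply]⟩
    · rintro _ ⟨x, hx, rfl⟩ _ ⟨y, hy, rfl⟩ hxy
      rw [← sub_eq_zero, ← map_sub]
      apply h _ (sub_mem hx hy)
      rw [pow_succ', Module.End.mul_apply, map_sub, map_sub, hxy, sub_self]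
    · rintro _ ⟨x, hx, rfl⟩
      exact ⟨_, ⟨x, hx, rfl⟩, by rw [pow_succ', Module.End.mul_apply]⟩

/-- The kernels of the powers of `Ω` on `⟨M⟩` form an ascending chain of subgroups of a finitely
generated abelian group, and so become stationary. -/
theorem exists_phiStable (M : ModuleCat.{u} Λ) [Module.Finite Λ M] : ∃ n, PhiStable M n := by
  have : IsNoetherian ℤ (genK M) := isNoetherian_of_fg_of_noetherian _ (genK_fg M)
  let c : ℕ →o Submodule ℤ (genK M) :=
    ⟨fun n => (LinearMap.ker (omegaK Λ ^ n)).comap (genK M).subtype,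
      monotone_nat_of_le_succ fun n x (hx : (omegaK Λ ^ n) x = 0) => by
        change (omegaK Λ ^ (n + 1)) x = 0
        rw [pow_succ', Module.End.mul_apply, hx, map_zero]⟩
  obtain ⟨n, hn⟩ := monotone_stabilizes_iff_noetherian.2 this c
  refine ⟨n, phiStable_iff.2 fun m hm x hx h => ?_⟩
  have h1 : (⟨x, hx⟩ : genK M) ∈ c (m + 1) := h
  rw [← hn _ (by omega), hn m hm] at h1
  exact h1

theorem igusaPhi_le {M : ModuleCat.{u} Λ} {n : ℕ} (h : PhiStable M n) : igusaPhi M ≤ n :=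
  iInf₂_le n h

theorem igusaPhi_lt_top (M : ModuleCat.{u} Λ) [Module.Finite Λ M] : igusaPhi M < ⊤ := by
  obtain ⟨n, hn⟩ := exists_phiStable M
  exact (igusaPhi_le hn).trans_lt (ENat.natCast_lt_top n)

theorem natCast_toNat_igusaPhi (M : ModuleCat.{u} Λ) [Module.Finite Λ M] :
    ((igusaPhi M).toNat : ℕ∞) = igusaPhi M :=
  ENat.natCast_toNat (igusaPhi_lt_top M).ne

theorem phiStable_toNat_igusaPhi (M : ModuleCat.{u} Λ) [Module.Finite Λ M] :
    PhiStable M (igusaPhi M).toNat := by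
  -- The infimum is finite, so a stable `n` lies strictly below its value plus one; this shows that
  -- the infimum is attained.
  have h : igusaPhi M < ((igusaPhi M).toNat + 1 : ℕ) := by
    conv_lhs => rw [← natCast_toNat_igusaPhi M]
    norm_cast
    omega
  simp only [igusaPhi, iInf_lt_iff] at h
  obtain ⟨n, hn, h⟩ := h
  have h : n < (igusaPhi M).toNat + 1 := Nat.cast_lt.1 h
  exact fun m hm => hn m (by omega)

/-- An element of `⟨M⟩` killed by some power of `Ω` is killed by `Ω^(Φ(M))`. -/
theorem omegaK_pow_igusaPhi_eq_zero {M : ModuleCat.{u} Λ} [Module.Finite Λ M] {x : GrK Λ}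
    (hx : x ∈ genK M) (n : ℕ) (h : (omegaK Λ ^ ((igusaPhi M).toNat + n)) x = 0) :
    (omegaK Λ ^ (igusaPhi M).toNat) x = 0 := by
  induction n with
  | zero => exact h
  | succ n ih => exact ih (phiStable_iff.1 (phiStable_toNat_igusaPhi M) _ (by omega) x hx h)

theorem Dom.igusaPhi_le {W V : ModuleCat.{u} Λ} [Module.Finite Λ W] (h : Dom W V) :
    igusaPhi V ≤ igusaPhi W := by
  rw [← natCast_toNat_igusaPhi W]
  refine FinDim.igusaPhi_le (phiStable_iff.2 fun m hm x hx => ?_)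
  exact phiStable_iff.1 (phiStable_toNat_igusaPhi W) m hm x (h.genK_le hx)

theorem igusaPsi_lt_top (M : ModuleCat.{u} Λ) [Module.Finite Λ M] : igusaPsi M < ⊤ :=
  WithTop.add_lt_top.2 ⟨igusaPhi_lt_top M, finDimClass_isSummand_lt_top _⟩

/-- With `Φ(W) = Φ(V) + d`, a summand `X` of `Ω^(Φ(V)) V` loses at most `d` in projective dimension
when replaced by `Ω^d X`, and this is dominated by `Ω^(Φ(W)) W`. The gap between the two values of
`Φ` pays for the loss. -/
theorem Dom.igusaPsi_le {W V : ModuleCat.{u} Λ} [Module.Finite Λ W] [Module.Finite Λ V]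
    (h : Dom W V) : igusaPsi V ≤ igusaPsi W := by
  have h1 := h.igusaPhi_le
  rw [igusaPsi, igusaPsi]
  rw [← natCast_toNat_igusaPhi V, ← natCast_toNat_igusaPhi W] at h1 ⊢
  simp only [ENat.toNat_natCast]
  generalize (igusaPhi V).toNat = a at *
  generalize (igusaPhi W).toNat = b at *
  norm_cast at h1
  obtain ⟨d, rfl⟩ := Nat.exists_eq_add_of_le' h1
  rw [add_comm d a, Nat.cast_add, add_assoc]
  refine add_le_add_right (iSup₂_le fun X hX => ?_) _
  have := hX.1.finite
  refine (pd_le_pd_syzPow d).trans (add_le_add_right ?_ _)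
  refine Dom.pd_le ?_ (pd_syzPow_lt_top d hX.2)
  rw [add_comm a d]
  refine (h.syzPow (d + a)).trans (Dom.of_isSummand ?_)
  rw [syzPow_add]
  exact hX.1.syzPow d

end Artinian

/-! ### The Igusa–Todorov inequality -/

/-- Since `Ext^(n+1)(D, Y) = 0`, every class in `Ext^n(X, Y)` is pulled back along `f`. The part of
`f` through `P` acts by zero, so every class is pulled back along `T`. Iterating, every class is
pulled back along a power of `T` that vanishes. The powers are supplied as the sequence `pw`. -/
theorem ext_eq_zero_of_nilpotent {𝒜 : Type*} [Category* 𝒜] [Abelian 𝒜] [HasExt 𝒜]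
    {X B D P : 𝒜} {f : X ⟶ B} {g : B ⟶ D} {w : f ≫ g = 0}
    (hS : (ShortComplex.mk f g w).ShortExact) {T : X ⟶ X} {i : X ⟶ B} {q : X ⟶ P} {j : P ⟶ B}
    (hf : f = T ≫ i + q ≫ j) (pw : ℕ → (X ⟶ X)) (hpw0 : pw 0 = 𝟙 X)
    (hpw : ∀ k, pw (k + 1) = pw k ≫ T) {k : ℕ} (hk : pw k = 0) {Y : 𝒜} {n : ℕ}
    (hP : ∀ e : Ext P Y n, e = 0) (hD : ∀ e : Ext D Y (1 + n), e = 0) (e : Ext X Y n) : e = 0 := by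
  have key : ∀ (k : ℕ) (e : Ext X Y n), ∃ e' : Ext X Y n,
      (Ext.mk₀ (pw k)).comp e' (zero_add n) = e := by
    intro k
    induction k with
    | zero => exact fun e => ⟨e, by rw [hpw0, Ext.mk₀_id_comp]⟩
    | succ k ih =>
      intro e
      obtain ⟨e₁, rfl⟩ := ih e
      obtain ⟨e₂, rfl⟩ := Ext.contravariant_sequence_exact₁ hS Y e₁ rfl (hD _)
      refine ⟨(Ext.mk₀ i).comp e₂ (zero_add n), ?_⟩
      have h1 : (Ext.mk₀ f).comp e₂ (zero_add n) =
          (Ext.mk₀ T).comp ((Ext.mk₀ i).comp e₂ (zero_add n)) (zero_add n) := by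
        rw [hf, Ext.mk₀_add, Ext.add_comp, ← Ext.mk₀_comp_mk₀, ← Ext.mk₀_comp_mk₀,
          Ext.comp_assoc_of_second_deg_zero, Ext.comp_assoc_of_second_deg_zero, hP (Ext.comp _ _ _),
          Ext.comp_zero, add_zero]
      dsimp only
      rw [h1, hpw, ← Ext.mk₀_comp_mk₀, Ext.comp_assoc_of_second_deg_zero]
  obtain ⟨e', rfl⟩ := key k e
  rw [hk, Ext.mk₀_zero, Ext.zero_comp]

/-- If `0 → X → X ⊕ P → C → 0` is exact with `P` projective, `pd C < ∞`, and the component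
`X → X` is nilpotent, then `pd X < ∞`. -/
theorem pd_lt_top_of_nilpotent {X P C : ModuleCat.{u} Λ} [Module.Projective Λ P]
    {t : Module.End Λ X} {p : X →ₗ[Λ] P} {g : X × P →ₗ[Λ] C} (ht : IsNilpotent t)
    (hinj : Function.Injective (LinearMap.prod t p)) (hex : Function.Exact (LinearMap.prod t p) g)
    (hg : Function.Surjective g) (hC : pd C < ⊤) : pd X < ⊤ := by
  let f : X ⟶ dsum X P := ModuleCat.ofHom (LinearMap.prod t p)
  let g' : dsum X P ⟶ C := ModuleCat.ofHom g
  have w : f ≫ g' = 0 := by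
    ext x
    exact hex.apply_apply_eq_zero x
  have hS : (ShortComplex.mk f g' w).ShortExact :=
    ModuleCat.shortComplex_shortExact _ hex hinj hg
  obtain ⟨n, hn⟩ := (pd_lt_top_iff _).1 hC
  rw [pd_le_iff] at hn
  have hP : HasProjectiveDimensionLT P 1 := by
    rw [← zero_add 1, ← pd_le_iff]
    exact (pd_eq_zero P).trans_le bot_le
  refine (pd_lt_top_iff _).2 ⟨n, (pd_le_iff _ _).2 ?_⟩
  let := HasExt.standard (ModuleCat.{u} Λ)
  rw [hasProjectiveDimensionLT_iff]
  intro i hi Y e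
  obtain ⟨k, hk⟩ := ht
  refine ext_eq_zero_of_nilpotent hS (T := ModuleCat.ofHom t)
    (i := (ModuleCat.ofHom (LinearMap.inl Λ X P) : X ⟶ dsum X P)) (q := ModuleCat.ofHom p)
    (j := (ModuleCat.ofHom (LinearMap.inr Λ X P) : P ⟶ dsum X P)) ?_
    (fun j => ModuleCat.ofHom (t ^ j)) rfl (fun j => ?_) (k := k) ?_
    (fun e => e.eq_zero_of_hasProjectiveDimensionLT 1 (by omega))
    (fun e => e.eq_zero_of_hasProjectiveDimensionLT (n + 1) (by omega)) e
  · ext x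
    exact Prod.ext (add_zero (t x)).symm (zero_add (p x)).symm
  · rw [pow_succ']
    rfl
  · rw [hk]
    rfl

section Artinian

variable [IsArtinianRing Λ]

/-- Take `Z = ker t^k` for large `k`, where `t` is the component `X → X`. On the complement `range
t^k` the map `t` is bijective, so restricting to `Z` leaves the cokernel `C` unchanged and makes `t`
nilpotent. -/
theorem exists_summand_of_ses {X P C : ModuleCat.{u} Λ} [Module.Finite Λ X] [Module.Projective Λ P]
    (h : SES X (dsum X P) C) (hC : pd C < ⊤) :
    ∃ Z : ModuleCat.{u} Λ, IsSummand Z X ∧ pd Z < ⊤ ∧ pd C ≤ pd Z + 1 := by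
  obtain ⟨(f : X →ₗ[Λ] X × P), (g : X × P →ₗ[Λ] C), hf, hfg, hg⟩ := h
  let t : Module.End Λ X := LinearMap.fst Λ X P ∘ₗ f
  let p : X →ₗ[Λ] P := LinearMap.snd Λ X P ∘ₗ f
  have hft : ∀ x, f x = (t x, p x) := fun x => rfl
  obtain ⟨k, hk, hk1⟩ := (t.eventually_isCompl_ker_pow_range_pow.and
    (Filter.eventually_ge_atTop 1)).exists
  have hker : ∀ x, (t ^ k) (t x) = 0 → (t ^ k) x = 0 := fun x hx => by
    refine Submodule.disjoint_def.1 hk.disjoint _ ?_ ⟨x, rfl⟩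
    obtain ⟨j, rfl⟩ : ∃ j, k = j + 1 := ⟨k - 1, by omega⟩
    rw [LinearMap.mem_ker, ← Module.End.mul_apply, ← pow_add,
      show j + 1 + (j + 1) = j + (j + 1 + 1) by ring, pow_add, pow_succ t (j + 1),
      Module.End.mul_apply, Module.End.mul_apply, hx, map_zero]
  have hker' : ∀ x, (t ^ k) x = 0 → (t ^ k) (t x) = 0 := fun x hx => by
    rw [← Module.End.mul_apply, ← pow_succ, pow_succ', Module.End.mul_apply, hx, map_zero]
  let K : Submodule Λ X := LinearMap.ker (t ^ k)
  let t' : Module.End Λ K := t.restrict hker'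
  let p' : K →ₗ[Λ] P := p ∘ₗ K.subtype
  let ι : K × P →ₗ[Λ] X × P := K.subtype.prodMap LinearMap.id
  have hι : Function.Injective ι :=
    Function.Injective.prodMap (Submodule.injective_subtype _) Function.injective_id
  have hcomm : ∀ z : K, ι (LinearMap.prod t' p' z) = f z.1 := fun z => rfl
  have hnil : IsNilpotent t' := by
    have h1 : ∀ j (z : K), ((t' ^ j) z).1 = (t ^ j) z.1 := by
      intro j z
      induction j with
      | zero => rfl
      | succ j ih => rw [pow_succ', pow_succ', Module.End.mul_apply, Module.End.mul_apply, ← ih]; rfl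
    exact ⟨k, LinearMap.ext fun z => Subtype.ext ((h1 k z).trans z.2)⟩
  have hinj : Function.Injective (LinearMap.prod t' p') := fun a b hab =>
    Subtype.ext (hf (congrArg ι hab))
  have hex : Function.Exact (LinearMap.prod t' p') (g ∘ₗ ι) := by
    intro y
    constructor
    · intro hy
      obtain ⟨x, hx⟩ := (hfg _).1 hy
      have h1 : t x = y.1.1 := congrArg Prod.fst hx
      exact ⟨⟨x, hker x (h1 ▸ y.1.2)⟩, hι hx⟩
    · rintro ⟨z, rfl⟩
      exact hfg.apply_apply_eq_zero z.1
  have hsurj : Function.Surjective (g ∘ₗ ι) := by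
    intro c
    obtain ⟨⟨x, q⟩, rfl⟩ := hg c
    obtain ⟨a, ha, _, ⟨b, rfl⟩, rfl⟩ :=
      Submodule.mem_sup.1 (hk.sup_eq_top ▸ Submodule.mem_top : x ∈ _ ⊔ _)
    obtain ⟨y, hy⟩ : ∃ y, t y = (t ^ k) b := by
      obtain ⟨j, rfl⟩ : ∃ j, k = j + 1 := ⟨k - 1, by omega⟩
      exact ⟨(t ^ j) b, by rw [pow_succ', Module.End.mul_apply]⟩
    -- Write `x = a + t^k b` and `t^k b = t y`, using `k ≥ 1`. Subtracting `f y`, which `g` kills,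
    -- moves `(x, q)` into `K × P`.
    refine ⟨((⟨a, ha⟩ : K), q - p y), ?_⟩
    have h1 : ι ((⟨a, ha⟩ : K), q - p y) = (a + (t ^ k) b, q) - f y := by
      refine Prod.ext ?_ rfl
      change a = a + (t ^ k) b - t y
      rw [hy, add_sub_cancel_right]
    rw [LinearMap.comp_apply, h1, map_sub]
    exact (congrArg _ (hfg.apply_apply_eq_zero y)).trans (sub_zero _)
  let Z : ModuleCat.{u} Λ := ModuleCat.of Λ K
  have hZ : pd Z < ⊤ := pd_lt_top_of_nilpotent (X := Z) hnil hinj hex hsurj hC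
  refine ⟨Z, ⟨ModuleCat.of Λ (LinearMap.range (t ^ k)),
    ⟨(Submodule.prodEquivOfIsCompl _ _ hk).symm⟩⟩, hZ, ?_⟩
  have hses : SES Z (dsum Z P) C := ⟨_, _, hinj, hex, hsurj⟩
  obtain ⟨n, hn⟩ := ENat.ne_top_iff_exists.1 hZ.ne
  rw [← hn]
  refine hses.pd_right hn.ge (pd_dsum_le (hn.ge.trans ?_) ((pd_eq_zero P).trans_le bot_le))
  norm_cast
  omega

/-- The inequality of Igusa and Todorov. -/
theorem SES.pd_le_igusaPsi {A B C : ModuleCat.{u} Λ} [Module.Finite Λ A] [Module.Finite Λ B]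
    [Module.Finite Λ C] (h : SES A B C) (hC : pd C < ⊤) :
    pd C ≤ igusaPsi (FinDim.dsum A B) + 1 := by
  let φ := (igusaPhi (FinDim.dsum A B)).toNat
  let a : FMod Λ := ⟨A, inferInstance⟩
  let b : FMod Λ := ⟨B, inferInstance⟩
  -- the classes of `A` and `B` agree after applying a power of `Ω`
  obtain ⟨r, hr⟩ := (pd_lt_top_iff _).1 hC
  -- The `(φ + r)`-th syzygy of `C` is projective because `r ≥ pd C`. The corresponding syzygy
  -- sequence therefore splits, and the classes of its other two terms agree.
  have hcls : (omegaK Λ ^ (φ + r)) (cls a - cls b) = 0 := by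
    obtain ⟨P, Q, hP, hP', hQ, hQ', hs⟩ := h.syzPow (φ + r)
    have : Module.Projective Λ (FinDim.syzPow (φ + r) C) :=
      projective_syzPow (hr.trans (by norm_cast; omega))
    obtain ⟨e⟩ := hs.split
    rw [map_sub, omegaK_pow_cls, omegaK_pow_cls, sub_eq_zero]
    have h1 := cls_of_equiv_prod
      (A := ⟨FinDim.syzPow (φ + r) A, inferInstance⟩)
      (B := ⟨FinDim.dsum (FinDim.syzPow (φ + r) C) Q, inferInstance⟩)
      (C := ⟨FinDim.dsum (FinDim.syzPow (φ + r) B) P, inferInstance⟩) e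
    have h2 := cls_of_equiv_prod
      (A := ⟨FinDim.syzPow (φ + r) B, inferInstance⟩) (B := ⟨P, hP⟩)
      (C := ⟨FinDim.dsum (FinDim.syzPow (φ + r) B) P, inferInstance⟩) (LinearEquiv.refl _ _)
    rw [h2, cls_eq_zero ⟨P, hP⟩ hP', cls_eq_zero ⟨FinDim.dsum (FinDim.syzPow (φ + r) C) Q, _⟩
      (inferInstanceAs (Module.Projective Λ (FinDim.dsum (FinDim.syzPow (φ + r) C) Q))),
      add_zero, add_zero] at h1
    exact h1.symm
  have hcls' : (omegaK Λ ^ φ) (cls a - cls b) = 0 :=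
    omegaK_pow_igusaPhi_eq_zero (sub_mem
      (genK_mono_of_isSummand (IsSummand.dsum_left A B) (cls_mem_genK a))
      (genK_mono_of_isSummand (IsSummand.dsum_right A B) (cls_mem_genK b))) r hcls
  rw [map_sub, omegaK_pow_cls, omegaK_pow_cls, sub_eq_zero] at hcls'
  obtain ⟨P₁, Q₁, hP₁, hQ₁, ⟨e⟩⟩ := stable_equiv_of_cls_eq hcls'
  obtain ⟨P, Q, hP, hP', hQ, hQ', hs⟩ := h.syzPow φ
  replace e : FinDim.dsum (FinDim.syzPow φ A) P₁.1 ≃ₗ[Λ] FinDim.dsum (FinDim.syzPow φ B) Q₁.1 := e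
  obtain ⟨P₁, fP₁⟩ := P₁
  obtain ⟨Q₁, fQ₁⟩ := Q₁
  let X := FinDim.dsum (FinDim.syzPow φ B) Q₁
  let C' := FinDim.dsum (FinDim.dsum (FinDim.syzPow φ C) Q) Q₁
  -- Adding `P₁` to the first two terms turns the first into `X` via `e`. Adding `Q₁` to the last
  -- two makes `X` a summand of the middle term as well.
  have hX : SES X (FinDim.dsum X (FinDim.dsum P P₁)) C' := by
    refine ((hs.prod_left P₁).prod_right Q₁).congr e ?_ (LinearEquiv.refl _ _)
    exact LinearEquiv.prodAssoc Λ _ _ _ ≪≫ₗ LinearEquiv.prodAssoc Λ _ _ _ ≪≫ₗ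
      (LinearEquiv.refl Λ _).prodCongr ((LinearEquiv.prodAssoc Λ _ _ _).symm ≪≫ₗ
        LinearEquiv.prodComm Λ _ _) ≪≫ₗ (LinearEquiv.prodAssoc Λ _ _ _).symm
  have hC' : pd C' < ⊤ := by
    obtain ⟨n, hn⟩ := (pd_lt_top_iff _).1 (pd_syzPow_lt_top φ hC)
    exact (pd_lt_top_iff _).2 ⟨n, pd_dsum_le (pd_dsum_le hn ((pd_eq_zero Q).trans_le bot_le))
      ((pd_eq_zero Q₁).trans_le bot_le)⟩
  obtain ⟨Z, hZX, hZ, hZC⟩ := exists_summand_of_ses hX hC'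
  have : Module.Finite Λ Z := hZX.finite
  have hdom : Dom (FinDim.syzPow φ (FinDim.dsum A B)) Z := by
    refine Dom.trans ?_ (Dom.of_isSummand hZX)
    exact Dom.prod (LinearEquiv.refl _ _)
      (Dom.of_isSummand ((IsSummand.dsum_right A B).syzPow φ)) (Dom.of_projective _ _)
  calc pd C ≤ φ + pd (FinDim.syzPow φ C) := pd_le_pd_syzPow φ
    _ ≤ φ + (pd Z + 1) := add_le_add_right ((pd_le_of_summand
        ((IsSummand.dsum_left _ Q).trans (IsSummand.dsum_left _ Q₁))).trans hZC) _
    _ ≤ φ + ((finDimClass fun X => IsSummand X (FinDim.syzPow φ (FinDim.dsum A B))) + 1) :=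
        add_le_add_right (add_le_add_left (hdom.pd_le hZ) _) _
    _ = igusaPsi (FinDim.dsum A B) + 1 := by
        rw [igusaPsi, ← add_assoc, natCast_toNat_igusaPhi]

/-- The form in which the inequality is applied: for an exact sequence `0 → A → B → C → 0` the
projective dimension of `C` is controlled by a module dominating `Ω^(m+1) C` and `Ω^m A`. -/
theorem SES.pd_mid_le_igusaPsi {A B C W : ModuleCat.{u} Λ} [Module.Finite Λ A] [Module.Finite Λ B]
    [Module.Finite Λ C] [Module.Finite Λ W] (h : SES A B C) (hB : pd B < ⊤) (m : ℕ)
    (hWC : Dom W (FinDim.syzPow (m + 1) C)) (hWA : Dom W (FinDim.syzPow m A)) :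
    pd B ≤ m + (igusaPsi W + 1) := by
  -- The inequality bounds the right-hand term of a sequence, so `B` is first rotated into that
  -- position; this costs one extra syzygy of `C`.
  obtain ⟨P, _, _, h⟩ := h.rotate
  obtain ⟨P', Q, _, _, _, _, h⟩ := h.syzPow m
  have hB' : pd (FinDim.dsum (FinDim.syzPow m B) Q) < ⊤ := by
    obtain ⟨n, hn⟩ := (pd_lt_top_iff _).1 (pd_syzPow_lt_top m hB)
    exact (pd_lt_top_iff _).2 ⟨n, pd_dsum_le hn ((pd_eq_zero Q).trans_le bot_le)⟩
  have hdom : Dom W (FinDim.dsum (FinDim.syzPow m (FinDim.syz C))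
      (FinDim.dsum (FinDim.syzPow m (FinDim.dsum A P)) P')) := by
    refine Dom.prod (LinearEquiv.refl _ _) ?_ (Dom.prod (LinearEquiv.refl _ _) ?_
      (Dom.of_projective _ _))
    · rwa [syzPow_add] at hWC
    · obtain ⟨e⟩ := syzPow_dsum m A P
      exact Dom.prod e hWA (Dom.of_projective _ _)
  calc pd B ≤ m + pd (FinDim.syzPow m B) := pd_le_pd_syzPow m
    _ ≤ m + (igusaPsi W + 1) := add_le_add_right
        (((pd_le_of_summand (IsSummand.dsum_left _ Q)).trans (h.pd_le_igusaPsi hB')).trans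
          (add_le_add_left hdom.igusaPsi_le _)) _

end Artinian

/-! ### Factoring linear maps -/

theorem exists_factor_of_injective {A M K : ModuleCat.{u} Λ} {f : A →ₗ[Λ] M}
    (hf : Function.Injective f) (h : K →ₗ[Λ] M) (hh : ∀ k, ∃ a, f a = h k) :
    ∃ l : K →ₗ[Λ] A, ∀ k, f (l k) = h k :=
  ⟨(LinearEquiv.ofInjective f hf).symm.toLinearMap ∘ₗ h.codRestrict (LinearMap.range f) hh,
    fun k => congrArg Subtype.val ((LinearEquiv.ofInjective f hf).apply_symm_apply ⟨h k, hh k⟩)⟩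

theorem exists_factor_of_surjective {M B D : ModuleCat.{u} Λ} {g : M →ₗ[Λ] B}
    (hg : Function.Surjective g) (h : M →ₗ[Λ] D) (hh : ∀ m, g m = 0 → h m = 0) :
    ∃ l : B →ₗ[Λ] D, ∀ m, l (g m) = h m := by
  refine ⟨(LinearMap.ker g).liftQ h hh ∘ₗ (g.quotKerEquivOfSurjective hg).symm.toLinearMap,
    fun m => ?_⟩
  have : (g.quotKerEquivOfSurjective hg).symm (g m) = (LinearMap.ker g).mkQ m := by
    rw [LinearEquiv.symm_apply_eq]
    rfl
  rw [LinearMap.comp_apply, LinearEquiv.coe_coe, this]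
  rfl

/-! ### Classes of modules -/

/-- Modules that are extensions of a module in `ℬ` by a submodule in `𝒜`. -/
def ExtBy (𝒜 ℬ : ModuleCat.{u} Λ → Prop) (M : ModuleCat.{u} Λ) : Prop :=
  ∃ A B : ModuleCat.{u} Λ, 𝒜 A ∧ ℬ B ∧ SES A M B

/-- A class is closed under submodules. -/
def ClosedSub (𝒜 : ModuleCat.{u} Λ → Prop) : Prop :=
  ∀ (A B : ModuleCat.{u} Λ) (f : A →ₗ[Λ] B), Function.Injective f → 𝒜 B → 𝒜 A

/-- A class is closed under quotients. -/
def ClosedQuot (𝒜 : ModuleCat.{u} Λ → Prop) : Prop :=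
  ∀ (A B : ModuleCat.{u} Λ) (f : A →ₗ[Λ] B), Function.Surjective f → 𝒜 A → 𝒜 B

/-- A class is closed under direct sums. -/
def ClosedSum (𝒜 : ModuleCat.{u} Λ → Prop) : Prop :=
  ∀ A B : ModuleCat.{u} Λ, 𝒜 A → 𝒜 B → 𝒜 (dsum A B)

theorem ExtBy.mono {𝒜 ℬ 𝒜' ℬ' : ModuleCat.{u} Λ → Prop} (h : ∀ M, 𝒜 M → 𝒜' M)
    (h' : ∀ M, ℬ M → ℬ' M) {M : ModuleCat.{u} Λ} (hM : ExtBy 𝒜 ℬ M) : ExtBy 𝒜' ℬ' M := by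
  obtain ⟨A, B, hA, hB, hs⟩ := hM
  exact ⟨A, B, h A hA, h' B hB, hs⟩

theorem SES.of_surjective {M B : ModuleCat.{u} Λ} {g : M →ₗ[Λ] B} (hg : Function.Surjective g) :
    SES (ModuleCat.of Λ (LinearMap.ker g)) M B :=
  ⟨(LinearMap.ker g).subtype, g, Submodule.injective_subtype _, LinearMap.exact_subtype_ker_map g,
    hg⟩

/-- For `A ⊆ N ⊆ M`, factor out `A` first: `M / A` is an extension of `M / N` by `N / A`. -/
theorem ExtBy.assoc {𝒜 ℬ 𝒞 : ModuleCat.{u} Λ → Prop} {M : ModuleCat.{u} Λ}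
    (h : ExtBy (ExtBy 𝒜 ℬ) 𝒞 M) : ExtBy 𝒜 (ExtBy ℬ 𝒞) M := by
  obtain ⟨N, C, ⟨A, B, hA, hB, f, g, hf, hfg, hg⟩, hC, f', g', hf', hfg', hg'⟩ := h
  let Q : ModuleCat.{u} Λ := ModuleCat.of Λ (M ⧸ LinearMap.range (f' ∘ₗ f))
  let π : M →ₗ[Λ] Q := (LinearMap.range (f' ∘ₗ f)).mkQ
  have hπ : Function.Surjective π := Submodule.mkQ_surjective _
  have hπ0 : ∀ m, π m = 0 ↔ ∃ a, f' (f a) = m := fun m => Submodule.Quotient.mk_eq_zero _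
  obtain ⟨i, hi⟩ := exists_factor_of_surjective hg (π ∘ₗ f') fun n hn => by
    obtain ⟨a, rfl⟩ := (hfg n).1 hn
    exact (hπ0 _).2 ⟨a, rfl⟩
  obtain ⟨q, hq⟩ := exists_factor_of_surjective hπ g' fun m hm => by
    obtain ⟨a, rfl⟩ := (hπ0 m).1 hm
    exact hfg'.apply_apply_eq_zero _
  refine ⟨A, Q, hA, ⟨B, C, hB, hC, i, q, ?_, ?_, ?_⟩, f' ∘ₗ f, π, hf'.comp hf, hπ0, hπ⟩
  · refine (injective_iff_map_eq_zero i).2 fun b hb => ?_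
    obtain ⟨n, rfl⟩ := hg b
    rw [hi] at hb
    obtain ⟨a, ha⟩ := (hπ0 _).1 hb
    rw [← hf' ha, hfg.apply_apply_eq_zero]
  · intro x
    obtain ⟨m, rfl⟩ := hπ x
    rw [hq, hfg' m]
    constructor
    · rintro ⟨n, rfl⟩
      exact ⟨g n, hi n⟩
    · rintro ⟨b, hb⟩
      obtain ⟨n, rfl⟩ := hg b
      rw [hi] at hb
      obtain ⟨a, ha⟩ := (hπ0 (m - f' n)).1 (by rw [map_sub, ← hb]; exact sub_self _)
      exact ⟨n + f a, by rw [map_add, ha, add_sub_cancel]⟩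
  · intro c
    obtain ⟨m, rfl⟩ := hg' c
    exact ⟨π m, hq m⟩

theorem ClosedSub.extBy {𝒜 ℬ : ModuleCat.{u} Λ → Prop} (h𝒜 : ClosedSub 𝒜) (hℬ : ClosedSub ℬ) :
    ClosedSub (ExtBy 𝒜 ℬ) := by
  rintro M' M i hi ⟨A, B, hA, hB, f, g, hf, hfg, hg⟩
  let K : ModuleCat.{u} Λ := ModuleCat.of Λ (LinearMap.ker (g ∘ₗ i))
  obtain ⟨l, hl⟩ := exists_factor_of_injective (K := K) hf (i ∘ₗ (LinearMap.ker (g ∘ₗ i)).subtype)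
    fun k => (hfg _).1 k.2
  refine ⟨K, ModuleCat.of Λ (LinearMap.range (g ∘ₗ i)), h𝒜 _ _ l ?_ hA,
    hℬ _ _ (LinearMap.range (g ∘ₗ i)).subtype (Submodule.injective_subtype _) hB,
    (LinearMap.ker (g ∘ₗ i)).subtype, (g ∘ₗ i).rangeRestrict, Submodule.injective_subtype _, ?_,
    LinearMap.surjective_rangeRestrict _⟩
  · intro a b hab
    refine Subtype.ext (hi ?_)
    have h1 := hl a
    rw [hab, hl b] at h1
    exact h1.symm
  · intro x
    rw [← (LinearMap.exact_subtype_ker_map (g ∘ₗ i)) x]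
    exact Subtype.ext_iff

theorem ClosedQuot.extBy {𝒜 ℬ : ModuleCat.{u} Λ → Prop} (h𝒜 : ClosedQuot 𝒜) (hℬ : ClosedQuot ℬ) :
    ClosedQuot (ExtBy 𝒜 ℬ) := by
  rintro M M' p hp ⟨A, B, hA, hB, f, g, hf, hfg, hg⟩
  let Q : ModuleCat.{u} Λ := ModuleCat.of Λ (M' ⧸ LinearMap.range (p ∘ₗ f))
  obtain ⟨l, hl⟩ := exists_factor_of_surjective (D := Q) hg
    ((LinearMap.range (p ∘ₗ f)).mkQ ∘ₗ p) fun m hm => by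
      obtain ⟨a, rfl⟩ := (hfg m).1 hm
      exact (Submodule.Quotient.mk_eq_zero _).2 ⟨a, rfl⟩
  refine ⟨ModuleCat.of Λ (LinearMap.range (p ∘ₗ f)), Q,
    h𝒜 _ _ (p ∘ₗ f).rangeRestrict (LinearMap.surjective_rangeRestrict _) hA, hℬ _ _ l ?_ hB,
    SES.of_submodule _⟩
  intro x
  obtain ⟨m', rfl⟩ := Submodule.mkQ_surjective _ x
  obtain ⟨m, rfl⟩ := hp m'
  exact ⟨g m, hl m⟩

theorem ClosedSum.extBy {𝒜 ℬ : ModuleCat.{u} Λ → Prop} (h𝒜 : ClosedSum 𝒜) (hℬ : ClosedSum ℬ) :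
    ClosedSum (ExtBy 𝒜 ℬ) := by
  rintro M M' ⟨A, B, hA, hB, f, g, hf, hfg, hg⟩ ⟨A', B', hA', hB', f', g', hf', hfg', hg'⟩
  refine ⟨dsum A A', dsum B B', h𝒜 _ _ hA hA', hℬ _ _ hB hB',
    (f.prodMap f' : A × A' →ₗ[Λ] M × M'), (g.prodMap g' : M × M' →ₗ[Λ] B × B'),
    Function.Injective.prodMap hf hf', ?_, Function.Surjective.prodMap hg hg'⟩
  rintro ⟨m, m'⟩
  constructor
  · intro h
    obtain ⟨a, rfl⟩ := (hfg m).1 (congrArg Prod.fst h)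
    obtain ⟨a', rfl⟩ := (hfg' m').1 (congrArg Prod.snd h)
    exact ⟨(a, a'), rfl⟩
  · rintro ⟨⟨a, a'⟩, h⟩
    obtain rfl : f a = m := congrArg Prod.fst h
    obtain rfl : f' a' = m' := congrArg Prod.snd h
    exact Prod.ext (hfg.apply_apply_eq_zero a) (hfg'.apply_apply_eq_zero a')

/-! ### Semisimple modules -/

/-- The class of semisimple modules. -/
def SemiS (M : ModuleCat.{u} Λ) : Prop := IsSemisimpleModule Λ M

theorem closedSub_semiS : ClosedSub (SemiS (Λ := Λ)) := fun _ _ f hf h =>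
  have : IsSemisimpleModule Λ _ := h
  IsSemisimpleModule.of_injective f hf

theorem closedQuot_semiS : ClosedQuot (SemiS (Λ := Λ)) := fun _ _ f hf h =>
  have : IsSemisimpleModule Λ _ := h
  IsSemisimpleModule.of_surjective f hf

theorem closedSum_semiS : ClosedSum (SemiS (Λ := Λ)) := by
  intro A B hA hB
  have : IsSemisimpleModule Λ A := hA
  have : IsSemisimpleModule Λ B := hB
  have h := IsSemisimpleModule.sup (R := Λ) (M := A × B)
    (p := LinearMap.range (LinearMap.inl Λ A B)) (q := LinearMap.range (LinearMap.inr Λ A B))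
    (IsSemisimpleModule.range _) (IsSemisimpleModule.range _)
  rw [LinearMap.sup_range_inl_inr] at h
  exact IsSemisimpleModule.congr (Submodule.topEquiv (R := Λ) (M := A × B)).symm

/-! ### Modules filtered by simple modules of finite projective dimension -/

/-- All simple subquotients of `M` have finite projective dimension. -/
def FF (M : ModuleCat.{u} Λ) : Prop :=
  ∀ (T S : ModuleCat.{u} Λ) (i : T →ₗ[Λ] M) (q : T →ₗ[Λ] S), Function.Injective i →
    Function.Surjective q → IsSimpleModule Λ S → pd S < ⊤

theorem closedSub_FF : ClosedSub (FF (Λ := Λ)) := fun _ _ f hf h T S i q hi hq hS =>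
  h T S (f ∘ₗ i) q (hf.comp hi) hq hS

/-- A subquotient of a quotient of `A` is a subquotient of `A`: take the preimage in `A` of the
submodule. -/
theorem closedQuot_FF : ClosedQuot (FF (Λ := Λ)) := fun A B f hf h T S i q hi hq hS => by
  let U : Submodule Λ A := (LinearMap.range i).comap f
  obtain ⟨l, hl⟩ := exists_factor_of_injective (K := ModuleCat.of Λ U) hi (f ∘ₗ U.subtype)
    fun k => k.2
  refine h (ModuleCat.of Λ U) S U.subtype (q ∘ₗ l) U.injective_subtype (hq.comp fun t => ?_) hS
  obtain ⟨a, ha⟩ := hf (i t)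
  exact ⟨⟨a, t, ha.symm⟩, hi ((hl _).trans ha)⟩

theorem FF.of_ses {A M B : ModuleCat.{u} Λ} (h : SES A M B) (hA : FF A) (hB : FF B) : FF M := by
  obtain ⟨f, g, hf, hfg, hg⟩ := h
  intro T S i q hi hq hS
  let K : Submodule Λ T := LinearMap.ker (g ∘ₗ i)
  -- With `K = T ∩ A`: either `q` vanishes on `K`, and the simple module is a quotient of `T / K ⊆
  -- B`, or `K ⊆ A` already maps onto it.
  by_cases h0 : q ∘ₗ K.subtype = 0
  · obtain ⟨l, hl⟩ := exists_factor_of_surjective (B := ModuleCat.of Λ (LinearMap.range (g ∘ₗ i)))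
      (g := (g ∘ₗ i).rangeRestrict) (LinearMap.surjective_rangeRestrict _) q fun t ht =>
        LinearMap.congr_fun h0 ⟨t, congrArg Subtype.val ht⟩
    refine hB _ S (LinearMap.range (g ∘ₗ i)).subtype l (Submodule.injective_subtype _) ?_ hS
    intro s
    obtain ⟨t, rfl⟩ := hq s
    exact ⟨_, hl t⟩
  · obtain ⟨l, hl⟩ := exists_factor_of_injective (K := ModuleCat.of Λ K) hf (i ∘ₗ K.subtype)
      fun k => (hfg _).1 k.2
    refine hA (ModuleCat.of Λ K) S l (q ∘ₗ K.subtype) ?_ (LinearMap.surjective_of_ne_zero h0) hS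
    intro a b hab
    refine Subtype.ext (hi ?_)
    have h1 := hl a
    rw [hab, hl b] at h1
    exact h1.symm

theorem closedSum_FF : ClosedSum (FF (Λ := Λ)) := fun A B hA hB =>
  FF.of_ses (SES.dsum A B) hA hB

theorem FF.of_subsingleton {M : ModuleCat.{u} Λ} [Subsingleton M] : FF M := by
  intro T S i q hi hq hS
  have : Subsingleton T := hi.subsingleton
  have : Subsingleton S := hq.subsingleton
  exact (pd_of_subsingleton S).trans_lt (ENat.natCast_lt_top 0)

theorem FF.of_simple {S : ModuleCat.{u} Λ} [IsSimpleModule Λ S] (h : pd S < ⊤) : FF S := by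
  intro T S' i q hi hq hS'
  have : Nontrivial S' := IsSimpleModule.nontrivial Λ S'
  have hT : Nontrivial T := hq.nontrivial
  have h0 : i ≠ 0 := by
    rintro rfl
    exact not_subsingleton T ⟨fun a b => hi rfl⟩
  have e : T ≃ₗ[Λ] S := LinearEquiv.ofBijective i ⟨hi, LinearMap.surjective_of_ne_zero h0⟩
  have : IsSimpleModule Λ T := IsSimpleModule.congr e
  have hq0 : q ≠ 0 := by
    rintro rfl
    obtain ⟨x, hx⟩ := exists_ne (0 : S')
    obtain ⟨t, rfl⟩ := hq x
    exact hx rfl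
  have e' : T ≃ₗ[Λ] S' := LinearEquiv.ofBijective q (LinearMap.bijective_of_ne_zero hq0)
  rwa [← pd_congr e', pd_congr e]

theorem SES.of_le {M : ModuleCat.{u} Λ} {A B : Submodule Λ M} (h : A ≤ B) :
    SES (ModuleCat.of Λ A) (ModuleCat.of Λ B) (ModuleCat.of Λ (B ⧸ A.submoduleOf B)) :=
  (SES.of_submodule (M := ModuleCat.of Λ B) (A.submoduleOf B)).congr
    (Submodule.submoduleOfEquivOfLe h) (LinearEquiv.refl _ _) (LinearEquiv.refl _ _)

theorem FiltFin.induction {P : ModuleCat.{u} Λ → Prop}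
    (zero : ∀ A : ModuleCat.{u} Λ, Subsingleton A → P A)
    (step : ∀ A B S : ModuleCat.{u} Λ, SES A B S → IsSimpleModule Λ S → pd S < ⊤ → P A → P B)
    {M : ModuleCat.{u} Λ} (h : FiltFin M)
    (congr : ∀ A B : ModuleCat.{u} Λ, (A ≃ₗ[Λ] B) → P A → P B) : P M := by
  obtain ⟨m, c, h0, hm, h⟩ := h
  have key : ∀ i ≤ m, P (ModuleCat.of Λ (c i)) := by
    intro i
    induction i with
    | zero =>
      intro _
      rw [h0]
      exact zero _ (inferInstanceAs (Subsingleton (⊥ : Submodule Λ M)))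
    | succ i ih =>
      intro hi
      obtain ⟨hle, hs, hpd⟩ := h i (by omega)
      exact step _ _ _ (SES.of_le hle) hs hpd (ih (by omega))
  have h1 := key m le_rfl
  rw [hm] at h1
  exact congr _ _ Submodule.topEquiv h1

theorem FiltFin.ff {M : ModuleCat.{u} Λ} (h : FiltFin M) : FF M := by
  refine h.induction (P := FF) (fun A _ => FF.of_subsingleton) (fun A B S hs hS hpd hA => ?_)
    fun A B e => closedSub_FF B A e.symm e.symm.injective
  exact FF.of_ses hs hA (FF.of_simple hpd)

/-- The top `M / rad M` of a module. -/
def topM (M : ModuleCat.{u} Λ) : ModuleCat.{u} Λ := ModuleCat.of Λ (M ⧸ Module.jacobson Λ M)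

theorem ses_radM (M : ModuleCat.{u} Λ) : SES (radM M) M (topM M) :=
  SES.of_submodule (Module.jacobson Λ M)

section Artinian

variable [IsArtinianRing Λ]

theorem FF.filtFin {M : ModuleCat.{u} Λ} [Module.Finite Λ M] (h : FF M) : FiltFin M := by
  obtain ⟨c, h0, m, hm, hc⟩ := exists_covBy_seq_of_wellFoundedLT_wellFoundedGT (Submodule Λ M)
  refine ⟨m, c, isMin_iff_eq_bot.1 h0, isMax_iff_eq_top.1 hm, fun i hi => ?_⟩
  have hle := (hc i hi).le
  have hS : IsSimpleModule Λ (c (i + 1) ⧸ (c i).submoduleOf (c (i + 1))) :=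
    (covBy_iff_quot_is_simple hle).1 (hc i hi)
  exact ⟨hle, hS, h (ModuleCat.of Λ (c (i + 1))) (ModuleCat.of Λ _) (c (i + 1)).subtype
    (Submodule.mkQ _) (Submodule.injective_subtype _) (Submodule.mkQ_surjective _) hS⟩

theorem FF.pd_le {M : ModuleCat.{u} Λ} [Module.Finite Λ M] (h : FF M) {n : ℕ}
    (hn : alpha Λ ≤ n) : pd M ≤ n := by
  refine h.filtFin.induction (P := fun M => pd M ≤ n)
    (fun A _ => (pd_of_subsingleton A).trans_le bot_le) (fun A B S hs hS hpd hA => ?_)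
    fun A B e hA => (pd_congr e).ge.trans hA
  exact hs.pd_mid hA ((le_iSup₂_of_le S ⟨hS, hpd⟩ le_rfl).trans hn)

/-- The quotient of `M` by `S(M)` is filtered by simple modules of finite projective dimension. -/
theorem exists_ses_funS (M : ModuleCat.{u} Λ) [Module.Finite Λ M] :
    ∃ Q : ModuleCat.{u} Λ, FF Q ∧ SES (funS M) M Q := by
  let 𝒩 : Set (Submodule Λ M) := {N | FiltFin (ModuleCat.of Λ (M ⧸ N))}
  have hne : 𝒩.Nonempty := by
    refine ⟨⊤, FF.filtFin ?_⟩
    have : Subsingleton (ModuleCat.of Λ (M ⧸ (⊤ : Submodule Λ M))) :=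
      inferInstanceAs (Subsingleton (M ⧸ (⊤ : Submodule Λ M)))
    exact FF.of_subsingleton
  obtain ⟨N, hN, hmin⟩ := WellFounded.has_min (wellFounded_lt (α := Submodule Λ M)) 𝒩 hne
  -- The set `𝒩` is closed under intersections, because `M / (N ∩ N')` embeds in `M / N ⊕ M / N'`. A
  -- minimal member is thus the least one, and the infimum defining `S(M)` is attained.
  have hinf : ∀ N' ∈ 𝒩, N ≤ N' := by
    intro N' hN'
    let F : M →ₗ[Λ] (M ⧸ N) × (M ⧸ N') := LinearMap.prod N.mkQ N'.mkQ
    have hF : LinearMap.ker F = N ⊓ N' := by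
      rw [LinearMap.ker_prod, Submodule.ker_mkQ, Submodule.ker_mkQ]
    have h1 : N ⊓ N' ∈ 𝒩 := FF.filtFin (closedSub_FF (ModuleCat.of Λ (M ⧸ (N ⊓ N')))
      (dsum (ModuleCat.of Λ (M ⧸ N)) (ModuleCat.of Λ (M ⧸ N'))) ((N ⊓ N').liftQ F hF.ge)
      (LinearMap.ker_eq_bot.1 (Submodule.ker_liftQ_eq_bot _ _ _ hF.le))
      (closedSum_FF _ _ (FiltFin.ff hN) (FiltFin.ff hN')))
    exact inf_eq_left.1 (eq_of_le_of_not_lt inf_le_left (hmin _ h1))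
  have hS : sInf 𝒩 = N := le_antisymm (sInf_le hN) (le_sInf hinf)
  refine ⟨ModuleCat.of Λ (M ⧸ N), FiltFin.ff hN, ?_⟩
  rw [← hS]
  exact SES.of_submodule (sInf 𝒩)

/-! ### Infinite-layer length and iterated extensions -/

instance finite_funS (M : ModuleCat.{u} Λ) [Module.Finite Λ M] : Module.Finite Λ (funS M) :=
  inferInstanceAs (Module.Finite Λ (_ : Submodule Λ M))

instance finite_radM (M : ModuleCat.{u} Λ) [Module.Finite Λ M] : Module.Finite Λ (radM M) :=
  inferInstanceAs (Module.Finite Λ (Module.jacobson Λ M))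

instance finite_topM (M : ModuleCat.{u} Λ) [Module.Finite Λ M] : Module.Finite Λ (topM M) :=
  inferInstanceAs (Module.Finite Λ (M ⧸ Module.jacobson Λ M))

theorem semiS_topM (M : ModuleCat.{u} Λ) [Module.Finite Λ M] : SemiS (topM M) := by
  have : IsArtinian Λ (topM M) := inferInstance
  exact (IsArtinian.isSemisimpleModule_iff_jacobson Λ (topM M)).2
    (Module.jacobson_quotient_jacobson Λ M)

end Artinian

/-- Modules with a filtration that has `i` semisimple layers, separated by layers filtered by simple
modules of finite projective dimension (built from the bottom). -/
def Lay : ℕ → ModuleCat.{u} Λ → Prop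
  | 0 => FF
  | i + 1 => ExtBy (ExtBy (Lay i) SemiS) FF

/-- The same class as `Lay`, built from the top. -/
def Up : ℕ → ModuleCat.{u} Λ → Prop
  | 0 => FF
  | i + 1 => ExtBy FF (ExtBy SemiS (Up i))

theorem closedSub_lay (i : ℕ) : ClosedSub (Lay (Λ := Λ) i) := by
  induction i with
  | zero => exact closedSub_FF
  | succ i ih => exact (ih.extBy closedSub_semiS).extBy closedSub_FF

theorem closedQuot_lay (i : ℕ) : ClosedQuot (Lay (Λ := Λ) i) := by
  induction i with
  | zero => exact closedQuot_FF
  | succ i ih => exact (ih.extBy closedQuot_semiS).extBy closedQuot_FF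

theorem closedSum_lay (i : ℕ) : ClosedSum (Lay (Λ := Λ) i) := by
  induction i with
  | zero => exact closedSum_FF
  | succ i ih => exact (ih.extBy closedSum_semiS).extBy closedSum_FF

theorem closedQuot_up (i : ℕ) : ClosedQuot (Up (Λ := Λ) i) := by
  induction i with
  | zero => exact closedQuot_FF
  | succ i ih => exact closedQuot_FF.extBy (closedQuot_semiS.extBy ih)

/-- Both classes describe the same alternating chain of layers; reassociation carries the pair of
layers added on top past the `i` pairs below it. -/
theorem up_succ_of_extBy (i : ℕ) {M : ModuleCat.{u} Λ} (h : ExtBy (Up i) (ExtBy SemiS FF) M) :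
    Up (i + 1) M := by
  induction i generalizing M with
  | zero => exact h
  | succ i ih =>
    exact h.assoc.mono (fun _ => id) fun _ h => h.assoc.mono (fun _ => id) fun _ => ih

theorem Lay.up {i : ℕ} {M : ModuleCat.{u} Λ} (h : Lay i M) : Up i M := by
  induction i generalizing M with
  | zero => exact h
  | succ i ih => exact up_succ_of_extBy i (h.assoc.mono (fun _ => ih) fun _ => id)

section Artinian

variable [IsArtinianRing Λ]

theorem lay_of_iterate (i : ℕ) (M : ModuleCat.{u} Λ) [Module.Finite Λ M]
    (h : Subsingleton ((fun X => funS (radM X))^[i] (funS M))) : Lay i M := by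
  induction i generalizing M with
  | zero =>
    obtain ⟨Q, hQ, hs⟩ := exists_ses_funS M
    have : Subsingleton (funS M) := h
    exact FF.of_ses hs FF.of_subsingleton hQ
  | succ i ih =>
    obtain ⟨Q, hQ, hs⟩ := exists_ses_funS M
    exact ⟨funS M, Q, ⟨radM (funS M), topM (funS M), ih _ h, semiS_topM _, ses_radM _⟩, hQ, hs⟩

theorem lay_infLayerLength (M : ModuleCat.{u} Λ) [Module.Finite Λ M] :
    Lay (infLayerLength M) M :=
  lay_of_iterate _ M (Nat.sInf_mem (exists_infLayerLength M))

end Artinian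

/-- A finitely generated module is a quotient of some `Λ^n`, and `Lay i` is closed under sums and
quotients. This bounds `fin.dim Λ` by the layers of `Λ` itself, with no comparison of infinite-layer
lengths. -/
theorem lay_of_lay_self {i : ℕ} (h : Lay i (ModuleCat.of Λ Λ)) (M : ModuleCat.{u} Λ)
    [Module.Finite Λ M] : Lay i M := by
  obtain ⟨n, f, hf⟩ := Module.Finite.exists_fin' Λ M
  refine closedQuot_lay i (ModuleCat.of Λ (Fin n → Λ)) M f hf ?_
  clear hf f
  induction n with
  | zero =>
    refine closedSub_lay i _ _ (0 : (Fin 0 → Λ) →ₗ[Λ] Λ) ?_ h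
    exact fun a b _ => Subsingleton.elim a b
  | succ n ih =>
    exact closedSub_lay i _ (dsum (ModuleCat.of Λ Λ) (ModuleCat.of Λ (Fin n → Λ)))
      (Fin.consLinearEquiv Λ (fun _ : Fin (n + 1) => Λ)).symm.toLinearMap
      (LinearEquiv.injective _) (closedSum_lay i _ _ h ih)

/-! ### The simple modules -/

section Artinian

variable [IsArtinianRing Λ]

/-- A left artinian ring has finitely many isomorphism classes of simple modules. -/
instance finite_simpleClasses : Finite (Quotient (simpleSetoid Λ)) := by
  obtain ⟨c, h0, m, hm, hc⟩ := exists_covBy_seq_of_wellFoundedLT_wellFoundedGT (Submodule Λ Λ)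
  have key : ∀ x : Quotient (simpleSetoid Λ), ∃ i : Fin m,
      Nonempty ((c (i + 1) ⧸ (c i).submoduleOf (c (i + 1))) ≃ₗ[Λ] Λ ⧸ x.out.1) := by
    intro x
    obtain ⟨I, hI⟩ := x.out
    -- Jordan–Hölder: at the step where the composition series of `Λ` leaves `I`, its simple factor
    -- maps nontrivially, hence isomorphically, to `Λ / I`.
    obtain ⟨i, hi, hle, hnle⟩ : ∃ i < m, c i ≤ I ∧ ¬ c (i + 1) ≤ I := by
      by_contra! h
      have h1 : ∀ i ≤ m, c i ≤ I := by
        intro i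
        induction i with
        | zero => exact fun _ => (isMin_iff_eq_bot.1 h0).trans_le bot_le
        | succ i ih => exact fun hi => h i (by omega) (ih (by omega))
      exact hI.1 (top_le_iff.1 ((isMax_iff_eq_top.1 hm).ge.trans (h1 m le_rfl)))
    refine ⟨⟨i, hi⟩, ?_⟩
    have : IsSimpleModule Λ (c (i + 1) ⧸ (c i).submoduleOf (c (i + 1))) :=
      (covBy_iff_quot_is_simple (hc i hi).le).1 (hc i hi)
    have : IsSimpleModule Λ (Λ ⧸ I) := isSimpleModule_iff_isCoatom.2 hI
    let F : (c (i + 1) ⧸ (c i).submoduleOf (c (i + 1))) →ₗ[Λ] Λ ⧸ I :=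
      Submodule.mapQ _ I (c (i + 1)).subtype fun x hx => hle hx
    refine ⟨LinearEquiv.ofBijective F (LinearMap.bijective_of_ne_zero fun hF => hnle fun x hx => ?_)⟩
    have h1 : F (Submodule.Quotient.mk ⟨x, hx⟩) = 0 := by rw [hF]; rfl
    exact (Submodule.Quotient.mk_eq_zero I).1 h1
  choose i hi using key
  refine Finite.of_injective i fun x y hxy => ?_
  obtain ⟨e⟩ := hi x
  obtain ⟨e'⟩ := hi y
  rw [← hxy] at e'
  exact Quotient.out_equiv_out.1 ⟨e.symm ≪≫ₗ e'⟩

end Artinian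

theorem exists_simpleRep_equiv (S : ModuleCat.{u} Λ) [IsSimpleModule Λ S] :
    ∃ c : Quotient (simpleSetoid Λ), Nonempty (S ≃ₗ[Λ] simpleRep c) := by
  obtain ⟨I, hI, ⟨e⟩⟩ := isSimpleModule_iff_quot_maximal.1 ‹IsSimpleModule Λ S›
  let x : {I : Submodule Λ Λ // IsCoatom I} := ⟨I, hI.1⟩
  obtain ⟨i⟩ := Quotient.mk_out (s := simpleSetoid Λ) x
  exact ⟨Quotient.mk (simpleSetoid Λ) x, ⟨e ≪≫ₗ i.symm⟩⟩

theorem isSummand_sigmaInf {S : ModuleCat.{u} Λ} [IsSimpleModule Λ S] (h : pd S = ⊤) :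
    IsSummand S (sigmaInf Λ) := by
  classical
  obtain ⟨c, ⟨e⟩⟩ := exists_simpleRep_equiv S
  let ι := {c : Quotient (simpleSetoid Λ) // pd (simpleRep c) = ⊤}
  let x : ι := ⟨c, (pd_congr e).symm.trans h⟩
  refine (IsSummand.of_equiv e).trans (IsSummand.of_retract
    (DirectSum.lof Λ ι (fun c => simpleRep c.1) x)
    (DirectSum.component Λ ι (fun c => simpleRep c.1) x) fun a => ?_)
  exact DirectSum.component.lof_self (M := fun c : ι => simpleRep c.1) Λ x a

/-- A semisimple module all of whose simple direct summands have infinite projective dimension is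
a direct sum of direct summands of `Σ`. -/
theorem dom_sigmaInf {V : ModuleCat.{u} Λ} (hV : SemiS V)
    (h : ∀ S : ModuleCat.{u} Λ, IsSimpleModule Λ S → IsSummand S V → pd S = ⊤) :
    Dom (sigmaInf Λ) V := by
  intro X _ hX hs
  right
  obtain ⟨i, r, hr⟩ := hs.exists_retract
  have : IsSemisimpleModule Λ X := closedSub_semiS X V i (Function.LeftInverse.injective hr) hV
  obtain ⟨hn, hX⟩ := (indecomposable_iff X).1 hX
  obtain ⟨m, hm⟩ := IsSemisimpleModule.exists_simple_submodule Λ X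
  obtain ⟨n, hmn⟩ := exists_isCompl m
  have hX' : IsSimpleModule Λ X := by
    let e := Submodule.prodEquivOfIsCompl m n hmn
    rcases hX (ModuleCat.of Λ m) (ModuleCat.of Λ n) e.symm with h | h
    · have : Nontrivial m := IsSimpleModule.nontrivial Λ m
      exact absurd h (not_subsingleton m)
    · have : Subsingleton n := h
      have : Unique n := uniqueOfSubsingleton 0
      exact IsSimpleModule.congr (e.symm ≪≫ₗ LinearEquiv.prodUnique)
  exact isSummand_sigmaInf (h X hX' hs)

theorem InAdd.of_isSummand {X L : ModuleCat.{u} Λ} (h : IsSummand X L) : InAdd L X :=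
  ⟨1, h.trans (IsSummand.of_equiv (LinearEquiv.funUnique (Fin 1) Λ L).symm)⟩

/-! ### Torsion and radical, torsion and socle -/

/-- The radical dies in every semisimple quotient, so `rad N` lies in the submodule with `i` layers.
-/
theorem lay_radM {i : ℕ} {N : ModuleCat.{u} Λ} (h : ExtBy (Lay i) SemiS N) : Lay i (radM N) := by
  obtain ⟨B, T, hB, hT, f, g, hf, hfg, hg⟩ := h
  have : IsSemisimpleModule Λ T := hT
  obtain ⟨l, hl⟩ := exists_factor_of_injective (K := radM N) hf (Module.jacobson Λ N).subtype
    fun k => (hfg _).1 (IsSemisimpleModule.jacobson_le_ker Λ Λ N T g k.2)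
  refine closedSub_lay i _ _ l (fun a b hab => Subtype.ext ?_) hB
  have h1 := hl a
  rw [hab, hl b] at h1
  exact h1.symm

/-- The socle of a module. -/
def socM (M : ModuleCat.{u} Λ) : ModuleCat.{u} Λ :=
  ModuleCat.of Λ (sSup {N : Submodule Λ M | IsSimpleModule Λ N} : Submodule Λ M)

theorem ses_socM (M : ModuleCat.{u} Λ) : SES (socM M) M (modSoc M) :=
  SES.of_submodule _

theorem semiS_socM (M : ModuleCat.{u} Λ) : SemiS (socM M) := by
  have h := isSemisimpleModule_biSup_of_isSemisimpleModule_submodule (R := Λ) (M := M)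
    (s := {N : Submodule Λ M | IsSimpleModule Λ N}) (p := id) fun N hN =>
      have : IsSimpleModule Λ N := hN
      inferInstanceAs (IsSemisimpleModule Λ N)
  have h1 := sSup_eq_iSup (s := {N : Submodule Λ M | IsSimpleModule Λ N})
  exact (congrArg (fun N : Submodule Λ M => IsSemisimpleModule Λ N) h1).mpr h

/-- The socle contains the semisimple submodule, so `N / soc N` is a quotient of the module in `Up
i`. -/
theorem up_modSoc {i : ℕ} {N : ModuleCat.{u} Λ} (h : ExtBy SemiS (Up i) N) : Up i (modSoc N) := by
  obtain ⟨T, U, hT, hU, f, g, hf, hfg, hg⟩ := h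
  have : IsSemisimpleModule Λ T := hT
  have hR : IsSemisimpleModule Λ (LinearMap.range f) := IsSemisimpleModule.range f
  have hle : LinearMap.range f ≤ sSup {N : Submodule Λ N | IsSimpleModule Λ N} := by
    rw [← Submodule.map_subtype_top (LinearMap.range f),
      ← IsSemisimpleModule.sSup_simples_eq_top Λ (LinearMap.range f),
      (Submodule.gc_map_comap _).l_sSup]
    refine iSup₂_le fun m hm => le_sSup ?_
    have : IsSimpleModule Λ m := hm
    exact IsSimpleModule.congr
      (Submodule.equivMapOfInjective _ (Submodule.injective_subtype _) m).symm
  obtain ⟨l, hl⟩ := exists_factor_of_surjective (D := modSoc N) hg (Submodule.mkQ _) fun m hm =>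
    (Submodule.Quotient.mk_eq_zero _).2 (hle ((hfg m).1 hm))
  refine closedQuot_up i _ _ l (fun x => ?_) hU
  obtain ⟨n, rfl⟩ := Submodule.mkQ_surjective _ x
  exact ⟨g n, hl n⟩

section Artinian

variable [IsArtinianRing Λ]

variable (Λ) in
theorem alpha_lt_top : alpha Λ < ⊤ := by
  obtain ⟨n, hn⟩ := Finite.exists_le fun c : Quotient (simpleSetoid Λ) => (pd (simpleRep c)).toNat
  refine lt_of_le_of_lt (iSup₂_le fun S hS => ?_) (ENat.natCast_lt_top n)
  have := hS.1
  obtain ⟨c, ⟨e⟩⟩ := exists_simpleRep_equiv S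
  have hpd := hS.2
  rw [pd_congr e] at hpd ⊢
  rw [← ENat.natCast_toNat hpd.ne]
  exact_mod_cast hn c

instance finite_sigmaInf : Module.Finite Λ (sigmaInf Λ) := by
  have : ∀ c : {c : Quotient (simpleSetoid Λ) // pd (simpleRep c) = ⊤},
      Module.Finite Λ (simpleRep c.1) := fun c =>
    inferInstanceAs (Module.Finite Λ (Λ ⧸ c.1.out.1))
  exact inferInstanceAs (Module.Finite Λ (DirectSum _ _))

/-- A module with `i + 1` layers has a submodule `N` with filtered quotient such that `top N` has no
simple summands of finite projective dimension and `rad N` has `i` layers. -/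
theorem exists_ses_lay {i : ℕ} {M : ModuleCat.{u} Λ} [Module.Finite Λ M] (h : Lay (i + 1) M) :
    ∃ N Q : ModuleCat.{u} Λ, Module.Finite Λ N ∧ FF Q ∧ SES N M Q ∧ Lay i (radM N) ∧
      ∀ S : ModuleCat.{u} Λ, IsSimpleModule Λ S → IsSummand S (topM N) → pd S = ⊤ := by
  obtain ⟨N, Q, hN, hQ, hs⟩ := h
  induction hl : Module.length Λ N using WellFoundedLT.induction generalizing N Q with
  | ind l ih =>
    have fN : Module.Finite Λ N := by
      obtain ⟨f, g, hf, -, -⟩ := hs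
      exact Module.Finite.of_injective f hf
    by_cases hgood : ∀ S : ModuleCat.{u} Λ, IsSimpleModule Λ S → IsSummand S (topM N) → pd S = ⊤
    · exact ⟨N, Q, fN, hQ, hs, lay_radM hN, hgood⟩
    push Not at hgood
    obtain ⟨S, hS, hsum, hpd⟩ := hgood
    obtain ⟨j, r, hr⟩ := hsum.exists_retract
    let q : N →ₗ[Λ] S := r ∘ₗ (Module.jacobson Λ N).mkQ
    have hq : Function.Surjective q :=
      (Function.RightInverse.surjective hr).comp (Submodule.mkQ_surjective _)
    let K : ModuleCat.{u} Λ := ModuleCat.of Λ (LinearMap.ker q)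
    have hK : ExtBy (Lay i) SemiS K := (closedSub_lay i).extBy closedSub_semiS K N
      (LinearMap.ker q).subtype (Submodule.injective_subtype _) hN
    have hlen : Module.length Λ K < Module.length Λ N := by
      refine Submodule.length_lt fun htop => ?_
      have : Nontrivial S := IsSimpleModule.nontrivial Λ S
      obtain ⟨x, hx⟩ := exists_ne (0 : S)
      obtain ⟨n, rfl⟩ := hq x
      exact hx (LinearMap.mem_ker.1 (htop ▸ Submodule.mem_top))
    -- Replacing `N` by the kernel `K` of `N → S` enlarges the quotient of `M` by the factor `S`,
    -- which has finite projective dimension. The length inequality is put into the class so that it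
    -- survives reassociation and drives the induction.
    have hext : ExtBy (ExtBy (fun A => ExtBy (Lay i) SemiS A ∧
        Module.length Λ A < Module.length Λ N) FF) FF M :=
      ⟨N, Q, ⟨K, S, ⟨hK, hlen⟩, FF.of_simple (lt_top_iff_ne_top.2 hpd), SES.of_surjective hq⟩,
        hQ, hs⟩
    obtain ⟨A, B, ⟨hA, hA'⟩, ⟨B', B'', hB', hB'', hsB⟩, hsA⟩ := hext.assoc
    exact ih _ (hl ▸ hA') A B hA (FF.of_ses hsB hB' hB'') hsA rfl

/-- A module with `i + 1` layers has a quotient `N` by a filtered submodule such that `soc N` has no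
simple summands of finite projective dimension and `N / soc N` has `i` layers. -/
theorem exists_ses_up {i : ℕ} {M : ModuleCat.{u} Λ} [Module.Finite Λ M] (h : Up (i + 1) M) :
    ∃ T N : ModuleCat.{u} Λ, Module.Finite Λ T ∧ Module.Finite Λ N ∧ FF T ∧ SES T M N ∧
      Up i (modSoc N) ∧
      ∀ S : ModuleCat.{u} Λ, IsSimpleModule Λ S → IsSummand S (socM N) → pd S = ⊤ := by
  obtain ⟨T, N, hT, hN, hs⟩ := h
  induction hl : Module.length Λ N using WellFoundedLT.induction generalizing T N with
  | ind l ih =>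
    obtain ⟨f, g, hf, hfg, hg⟩ := id hs
    have fN : Module.Finite Λ N := Module.Finite.of_surjective g hg
    by_cases hgood : ∀ S : ModuleCat.{u} Λ, IsSimpleModule Λ S → IsSummand S (socM N) → pd S = ⊤
    · exact ⟨T, N, Module.Finite.of_injective f hf, fN, hT, hs, up_modSoc hN, hgood⟩
    push Not at hgood
    obtain ⟨S, hS, hsum, hpd⟩ := hgood
    obtain ⟨j, r, hr⟩ := hsum.exists_retract
    let a : S →ₗ[Λ] N := (Submodule.subtype _) ∘ₗ j
    have ha : Function.Injective a :=
      (Submodule.injective_subtype _).comp (Function.LeftInverse.injective hr)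
    let N' : ModuleCat.{u} Λ := ModuleCat.of Λ (N ⧸ LinearMap.range a)
    let p : N →ₗ[Λ] N' := (LinearMap.range a).mkQ
    have hp : Function.Surjective p := Submodule.mkQ_surjective _
    have hp0 : ∀ n, p n = 0 ↔ ∃ s, a s = n := fun n => Submodule.Quotient.mk_eq_zero _
    have hN' : ExtBy SemiS (Up i) N' := closedQuot_semiS.extBy (closedQuot_up i) N N' p hp hN
    have hlen : Module.length Λ N' < Module.length Λ N := by
      refine Submodule.length_quotient_lt _ fun hbot => ?_
      have : Nontrivial S := IsSimpleModule.nontrivial Λ S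
      obtain ⟨x, hx⟩ := exists_ne (0 : S)
      have h1 : a x ∈ LinearMap.range a := ⟨x, rfl⟩
      rw [hbot, Submodule.mem_bot] at h1
      exact hx (ha (h1.trans (map_zero a).symm))
    -- The new submodule is the preimage in `M` of the simple submodule `S` of `N`, an extension of
    -- `S` by `T`.
    let T' : ModuleCat.{u} Λ := ModuleCat.of Λ (LinearMap.ker (p ∘ₗ g))
    obtain ⟨b, hb⟩ := exists_factor_of_injective (K := T') ha
      (g ∘ₗ (LinearMap.ker (p ∘ₗ g)).subtype) fun t => (hp0 _).1 t.2
    have hT' : FF T' := by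
      refine FF.of_ses (A := T) (B := S) ⟨f.codRestrict (LinearMap.ker (p ∘ₗ g)) fun t => ?_, b,
        fun x y hxy => hf (congrArg Subtype.val hxy), ?_, ?_⟩ hT
        (FF.of_simple (lt_top_iff_ne_top.2 hpd))
      · change p (g (f t)) = 0
        rw [hfg.apply_apply_eq_zero, map_zero]
      · intro t
        have h1 : b t = 0 ↔ g t.1 = 0 := by
          rw [← map_eq_zero_iff a ha, hb]
          rfl
        rw [h1, hfg]
        exact exists_congr fun x => (Subtype.ext_iff (a1 := f.codRestrict _ _ x)).symm
      · intro s
        obtain ⟨m, hm⟩ := hg (a s)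
        exact ⟨⟨m, (hp0 _).2 ⟨s, hm.symm⟩⟩, ha ((hb _).trans hm)⟩
    exact ih _ (hl ▸ hlen) T' N' hT' hN' (SES.of_surjective (hp.comp hg : _)) rfl

/-! ### The bounds -/

/-- Sort the indecomposable summands `X` of `V`. If `pd X = ∞`, then `Ω^(k+s) X = Ω^k (Ω^s X)` is
dominated by `Ω^k L`; if `pd X` is finite, then `pd X ≤ t ≤ k + s` and the syzygy is projective. -/
theorem dom_syzPow_of_inAdd {V L : ModuleCat.{u} Λ} [Module.Finite Λ V] [Module.Finite Λ L]
    {s t k : ℕ} (hk : t ≤ k)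
    (hinf : ∀ X : ModuleCat.{u} Λ, Indecomposable X → IsSummand X V → pd X = ⊤ →
      InAdd L (syzPow s X))
    (hfin : ∀ X : ModuleCat.{u} Λ, Module.Finite Λ X → IsSummand X V → pd X < ⊤ → pd X ≤ t) :
    Dom (syzPow k L) (syzPow (k + s) V) := by
  refine Dom.syzPow_of _ fun X fX hX hs => ?_
  rcases eq_or_ne (pd X) ⊤ with h | h
  · rw [syzPow_add]
    exact (Dom.of_inAdd (hinf X hX hs h)).syzPow k
  · have : Module.Projective Λ (syzPow (k + s) X) :=
      projective_syzPow ((hfin X fX hs (lt_top_iff_ne_top.2 h)).trans (by norm_cast; omega))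
    exact Dom.of_projective _ _

theorem boundK_lt_top (s : ℕ) (L : ModuleCat.{u} Λ) [Module.Finite Λ L] (i : ℕ) :
    boundK s L (alpha Λ) i < ⊤ := by
  induction i with
  | zero => exact alpha_lt_top Λ
  | succ i ih =>
    rw [boundK]
    exact WithTop.add_lt_top.2 ⟨WithTop.add_lt_top.2 ⟨WithTop.add_lt_top.2
      ⟨ih, ENat.natCast_lt_top 2⟩, ENat.natCast_lt_top s⟩, igusaPsi_lt_top _⟩

theorem boundC_lt_top (s : ℕ) (L : ModuleCat.{u} Λ) [Module.Finite Λ L] (i : ℕ) :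
    boundC s L (alpha Λ) i < ⊤ := by
  induction i with
  | zero => exact alpha_lt_top Λ
  | succ i ih =>
    rw [boundC]
    exact WithTop.add_lt_top.2 ⟨WithTop.add_lt_top.2 ⟨WithTop.add_lt_top.2
      ⟨ih, ENat.natCast_lt_top 2⟩, ENat.natCast_lt_top s⟩, igusaPsi_lt_top _⟩

theorem alpha_le_boundK (s : ℕ) (L : ModuleCat.{u} Λ) (i : ℕ) :
    alpha Λ ≤ boundK s L (alpha Λ) i := by
  induction i with
  | zero => exact le_rfl
  | succ i ih =>
    rw [boundK, add_assoc, add_assoc]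
    exact ih.trans le_self_add

theorem alpha_le_boundC (s : ℕ) (L : ModuleCat.{u} Λ) (i : ℕ) :
    alpha Λ ≤ boundC s L (alpha Λ) i := by
  induction i with
  | zero => exact le_rfl
  | succ i ih =>
    rw [boundC, add_assoc, add_assoc]
    exact ih.trans le_self_add

theorem pd_le_boundK {s : ℕ} {L : ModuleCat.{u} Λ} [Module.Finite Λ L]
    (hL : ∀ X : ModuleCat.{u} Λ, classK X → InAdd L (syzPow s X)) (i : ℕ) (M : ModuleCat.{u} Λ)
    [Module.Finite Λ M] (hM : pd M < ⊤) (h : Lay i M) : pd M ≤ boundK s L (alpha Λ) i := by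
  have hα : alpha Λ ≤ (alpha Λ).toNat := (ENat.natCast_toNat (alpha_lt_top Λ).ne).ge
  induction i generalizing M with
  | zero => exact (FF.pd_le h hα).trans (ENat.natCast_toNat_le_self _)
  | succ i ih =>
    obtain ⟨N, Q, fN, hQ, hs, hrad, htop⟩ := exists_ses_lay h
    have fQ : Module.Finite Λ Q := by
      obtain ⟨f, g, -, -, hg⟩ := hs
      exact Module.Finite.of_surjective g hg
    have hQpd := FF.pd_le hQ hα
    have hN : pd N < ⊤ := hs.pd_left_lt_top hM (hQpd.trans_lt (ENat.natCast_lt_top _))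
    obtain ⟨b, hb⟩ := ENat.ne_top_iff_exists.1 (boundK_lt_top s L (i + 1)).ne
    have hαb := alpha_le_boundK s L (i + 1)
    rw [← hb] at hαb ⊢
    refine hs.pd_mid ?_ (FF.pd_le hQ hαb)
    rw [hb, boundK]
    have ht := ENat.natCast_toNat (boundK_lt_top s L i).ne
    -- The bound is finite, so it may be replaced by its natural-number value `t`, which can serve
    -- as an exponent of `Ω`.
    replace ih := fun M h₁ h₂ h₃ => (@ih M h₁ h₂ h₃).trans ht.ge
    set t := (boundK s L (alpha Λ) i).toNat
    set W := dsum (syzPow (2 + s + t) (sigmaInf Λ)) (syzPow (1 + t) L)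
    have h1 : Dom W (syzPow (s + t + 1 + 1) (topM N)) := by
      rw [show s + t + 1 + 1 = 2 + s + t by omega]
      exact (Dom.of_isSummand (IsSummand.dsum_left _ _)).trans
        ((dom_sigmaInf (semiS_topM N) htop).syzPow _)
    have h2 : Dom W (syzPow (s + t + 1) (radM N)) := by
      rw [show s + t + 1 = 1 + t + s by omega]
      refine (Dom.of_isSummand (IsSummand.dsum_right _ _)).trans
        (dom_syzPow_of_inAdd (t := t) (by omega) (fun X hX hXs hpd => ?_) fun X fX hXs hpd => ?_)
      · exact hL X ⟨hX, hpd, N, fN, hN, InAdd.of_isSummand hXs⟩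
      · obtain ⟨j, r, hr⟩ := hXs.exists_retract
        exact ih X fX hpd (closedSub_lay i _ _ j (Function.LeftInverse.injective hr) hrad)
    -- The index `m = s + t + 1` gives `Ω^(m+1) = Ω^(2+s+t)` on `top N` and `Ω^m = Ω^(1+t) Ω^s` on
    -- `rad N`; with the `+ 1` of the inequality the total is `t + 2 + s + Ψ(W)`.
    refine ((ses_radM N).pd_mid_le_igusaPsi hN (s + t + 1) h1 h2).trans_eq ?_
    rw [← ht]
    push_cast
    ring

theorem pd_le_boundC {s : ℕ} {L : ModuleCat.{u} Λ} [Module.Finite Λ L]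
    (hL : ∀ X : ModuleCat.{u} Λ, classC X → InAdd L (syzPow s X)) (i : ℕ) (M : ModuleCat.{u} Λ)
    [Module.Finite Λ M] (hM : pd M < ⊤) (h : Up i M) : pd M ≤ boundC s L (alpha Λ) i := by
  have hα : alpha Λ ≤ (alpha Λ).toNat := (ENat.natCast_toNat (alpha_lt_top Λ).ne).ge
  induction i generalizing M with
  | zero => exact (FF.pd_le h hα).trans (ENat.natCast_toNat_le_self _)
  | succ i ih =>
    obtain ⟨T, N, fT, fN, hT, hs, hsoc, hsimple⟩ := exists_ses_up h
    have hTpd := FF.pd_le hT hα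
    have hN : pd N < ⊤ := hs.pd_right_lt_top (hTpd.trans_lt (ENat.natCast_lt_top _)) hM
    have f1 : Module.Finite Λ (socM N) := inferInstanceAs (Module.Finite Λ (_ : Submodule Λ N))
    have f2 : Module.Finite Λ (modSoc N) := inferInstanceAs
      (Module.Finite Λ (N ⧸ sSup {U : Submodule Λ N | IsSimpleModule Λ U}))
    obtain ⟨b, hb⟩ := ENat.ne_top_iff_exists.1 (boundC_lt_top s L (i + 1)).ne
    have hαb := alpha_le_boundC s L (i + 1)
    rw [← hb] at hαb ⊢
    refine hs.pd_mid (FF.pd_le hT hαb) ?_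
    rw [hb, boundC]
    have ht := ENat.natCast_toNat (boundC_lt_top s L i).ne
    replace ih := fun M h₁ h₂ h₃ => (@ih M h₁ h₂ h₃).trans ht.ge
    set t := (boundC s L (alpha Λ) i).toNat
    set W := dsum (syzPow (1 + s + t) (sigmaInf Λ)) (syzPow (2 + t) L)
    have h1 : Dom W (syzPow (s + t + 1 + 1) (modSoc N)) := by
      rw [show s + t + 1 + 1 = 2 + t + s by omega]
      refine (Dom.of_isSummand (IsSummand.dsum_right _ _)).trans
        (dom_syzPow_of_inAdd (t := t) (by omega) (fun X hX hXs hpd => ?_) fun X fX hXs hpd => ?_)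
      · exact hL X ⟨hX, hpd, N, fN, hN, InAdd.of_isSummand hXs⟩
      · obtain ⟨j, r, hr⟩ := hXs.exists_retract
        exact ih X fX hpd (closedQuot_up i _ _ r (Function.RightInverse.surjective hr) hsoc)
    have h2 : Dom W (syzPow (s + t + 1) (socM N)) := by
      rw [show s + t + 1 = 1 + s + t by omega]
      exact (Dom.of_isSummand (IsSummand.dsum_left _ _)).trans
        ((dom_sigmaInf (semiS_socM N) hsimple).syzPow _)
    -- Here the semisimple term is on the left, so `Σ` takes `m = 1 + s + t` syzygies, while `N /
    -- soc N` takes `m + 1`, whence `Ω^(2+t) L`.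
    refine ((ses_socM N).pd_mid_le_igusaPsi hN (s + t + 1) h1 h2).trans_eq ?_
    rw [← ht]
    push_cast
    ring

end Artinian

end FinDim

open FinDim

theorem mainTheorem4 (R : Type v) (Λ : Type u) [CommRing R] [IsArtinianRing R] [Ring Λ]
    [Algebra R Λ] [Module.Finite R Λ] :
    haveI : IsArtinianRing Λ := IsArtinianRing.of_finite R Λ
    -- the result for the class `𝒞(Λ)`
    (∀ (s : ℕ) (L : ModuleCat.{u} Λ), Module.Finite Λ L →
      (∀ X : ModuleCat.{u} Λ, classC X → InAdd L (syzPow s X)) →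
        (∀ i : ℕ, boundC s L (alpha Λ) i < ⊤) ∧
        (∀ M : ModuleCat.{u} Λ, Module.Finite Λ M → pd M < ⊤ →
          pd M ≤ boundC s L (alpha Λ) (infLayerLength M)) ∧
        finDim Λ ≤ boundC s L (alpha Λ) (infLayerLength (ModuleCat.of Λ Λ)) ∧
        boundC s L (alpha Λ) (infLayerLength (ModuleCat.of Λ Λ)) < ⊤) ∧
    -- the dual result for the class `𝒦(Λ)`
    (∀ (s : ℕ) (L : ModuleCat.{u} Λ), Module.Finite Λ L →
      (∀ X : ModuleCat.{u} Λ, classK X → InAdd L (syzPow s X)) →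
        (∀ i : ℕ, boundK s L (alpha Λ) i < ⊤) ∧
        (∀ M : ModuleCat.{u} Λ, Module.Finite Λ M → pd M < ⊤ →
          pd M ≤ boundK s L (alpha Λ) (infLayerLength M)) ∧
        finDim Λ ≤ boundK s L (alpha Λ) (infLayerLength (ModuleCat.of Λ Λ)) ∧
        boundK s L (alpha Λ) (infLayerLength (ModuleCat.of Λ Λ)) < ⊤) := by
  have : IsArtinianRing Λ := IsArtinianRing.of_finite R Λ
  have fΛ : Module.Finite Λ (ModuleCat.of Λ Λ) := inferInstanceAs (Module.Finite Λ Λ)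
  have hΛ := lay_infLayerLength (ModuleCat.of Λ Λ)
  refine ⟨fun s L fL hL => ⟨boundC_lt_top s L, fun M fM hM => ?_, iSup₂_le fun M hM => ?_,
    boundC_lt_top s L _⟩, fun s L fL hL => ⟨boundK_lt_top s L, fun M fM hM => ?_,
    iSup₂_le fun M hM => ?_, boundK_lt_top s L _⟩⟩
  · exact pd_le_boundC hL _ M hM (lay_infLayerLength M).up
  · have := hM.1
    -- The number of layers used here is that of `Λ`, so monotonicity of the bounding function is
    -- not needed.
    exact pd_le_boundC hL _ M hM.2 (lay_of_lay_self hΛ M).up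
  · exact pd_le_boundK hL _ M hM (lay_infLayerLength M)
  · have := hM.1
    exact pd_le_boundK hL _ M hM.2 (lay_of_lay_self hΛ M)
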